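/- Write \([v,w]=v_1w_2-v_2w_1\) for \(v,w\in\mathbb{R}^2\) and \(e_\theta=(-\sin\theta,\cos\theta)\). Let \(\mathcal{P}\subset\mathbb{R}^2\) be a compact strictly convex set, symmetric about the origin, whose boundary is a \(C^\infty\) curve of strictly positive curvature, and let \(p(\theta)\) be the \(2\pi\)-periodic smooth parametrization of \(\partial\mathcal{P}\) for which \(p'(\theta)\) is a positive multiple of \(e_\theta\) for every \(\theta\). Let \(\|\cdot\|_{\mathcal{P}}\) be the norm with unit ball \(\mathcal{P}\), let \(A(\mathcal{P})\) be the area of \(\mathcal{P}\), and let \(\mathcal{Q}=\{x\in\mathbb{R}^2 : |[w,x]|\le 1 \text{ for all } w\in\mathcal{P}\}\) be the dual unit ball, with norm \(\|\cdot\|_{\mathcal{Q}}\). Let \(\gamma\) be a smooth, simple, closed, strictly convex curve in \(\mathbb{R}^2\) with a regular parametrization \(\gamma(u)\); let \(A\) be the area it encloses, \(s\) its \(\mathcal{Q}\)-arclength, \(ds=\|\gamma'(u)\|_{\mathcal{Q}}\,du\), and \(L_{\mathcal{Q}}=\int ds\) its \(\mathcal{Q}\)-length. Let \(\theta\) be such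 that the tangent vector \(\gamma'(u)\) is a positive multiple of \(e_{\theta}\), and let \(k=[p(\theta),p'(\theta)]\,\frac{d\theta}{ds}\) be the Minkowski curvature of \(\gamma\). Then \[ \int_0^{L_{\mathcal{Q}}} k^2\,ds\;\ge\; A(\mathcal{P})\,\frac{L_{\mathcal{Q}}}{A}, \] with equality if and only if \(\gamma\) is a \(\mathcal{P}\)-circle, i.e. \(\gamma=\{x : \|x-c\|_{\mathcal{P}}=r\}\) for some \(c\in\mathbb{R}^2\) and \(r>0\). -/

import Mathlib

open scoped ContDiff

noncomputable section

namespace MinkowskiPlane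

/-- The plane `ℝ²`, with its Euclidean structure and Lebesgue area. -/
abbrev Plane : Type := EuclideanSpace ℝ (Fin 2)

/-- The determinant `[v, w]` of two plane vectors. -/
def det2 (v w : Plane) : ℝ := v 0 * w 1 - v 1 * w 0

/-- The unit vector `e_θ = (-sin θ, cos θ)`. -/
def eTheta (θ : ℝ) : Plane := !₂[-Real.sin θ, Real.cos θ]

/-- `P` is a strictly convex compact set, symmetric about the origin, whose boundary is the
smooth closed curve `p`, parametrized by the angle `θ` in such a way that `p' (θ)` is a positive
multiple of `e_θ`. The multiple is the radius of curvature `a + a''` of the boundary, where `a` is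
the support function of `P`; its positivity says that the boundary has positive curvature. -/
structure IsUnitBall (P : Set Plane) (p : ℝ → Plane) : Prop where
  isCompact : IsCompact P
  strictConvex : StrictConvex ℝ P
  symmetric : ∀ x ∈ P, -x ∈ P
  smooth : ContDiff ℝ ∞ p
  periodic : Function.Periodic p (2 * Real.pi)
  range_eq : Set.range p = frontier P
  deriv_eq : ∀ θ, ∃ c : ℝ, 0 < c ∧ deriv p θ = c • eTheta θ

/-- The dual unit ball of `P`, realized in the plane through the identification of a vector `q`
with the linear functional `w ↦ [w, q]`. -/
def dualBall (P : Set Plane) : Set Plane := {q | ∀ w ∈ P, |det2 w q| ≤ 1}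

/-- `γ` is a regular smooth parametrization, with period `T`, of a simple closed strictly convex
curve: its trace is the boundary of a strictly convex region, which is then the convex hull of
the trace. Either orientation is allowed. -/
structure IsStrictlyConvexCurve (γ : ℝ → Plane) (T : ℝ) : Prop where
  period_pos : 0 < T
  smooth : ContDiff ℝ ∞ γ
  regular : ∀ u, deriv γ u ≠ 0
  closed : Function.Periodic γ T
  simple : Set.InjOn γ (Set.Ico 0 T)
  strictConvex : StrictConvex ℝ (convexHull ℝ (Set.range γ))
  range_eq : Set.range γ = frontier (convexHull ℝ (Set.range γ))

/-- The area of a plane set. -/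
def area (K : Set Plane) : ℝ := (MeasureTheory.volume K).toReal

/-- The area enclosed by a (convex) curve. -/
def enclosedArea (γ : ℝ → Plane) : ℝ := area (convexHull ℝ (Set.range γ))

/-- The speed `v = ds/du` of `γ` for the norm whose unit ball is the dual ball `Q` of `P`. -/
def speedQ (P : Set Plane) (γ : ℝ → Plane) (u : ℝ) : ℝ := gauge (dualBall P) (deriv γ u)

/-- The `Q`-length of the closed curve `γ` of period `T`. -/
def lengthQ (P : Set Plane) (γ : ℝ → Plane) (T : ℝ) : ℝ := ∫ u in (0 : ℝ)..T, speedQ P γ u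

/-- The parameter `θ` of the curve at `γ u`: the angle from the `x`-axis to `γ' u` is
`θ + π / 2`, so that `γ' u` is a positive multiple of `e_θ` (determined modulo `2π`). -/
def tangentParam (γ : ℝ → Plane) (u : ℝ) : ℝ :=
  Complex.arg ⟨deriv γ u 0, deriv γ u 1⟩ - Real.pi / 2

/-- The rate `dθ/du = [γ', γ''] / |γ'|²` at which the direction of `γ'` turns. -/
def angularRate (γ : ℝ → Plane) (u : ℝ) : ℝ :=
  det2 (deriv γ u) (deriv (deriv γ) u) / ‖deriv γ u‖ ^ 2

/-- The Minkowski curvature `k = [p, p'] dθ/ds`, where `p` and `p'` are taken at the parameter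
`θ` of the curve and `dθ/ds = (dθ/du) / (ds/du)`. -/
def curvature (P : Set Plane) (p γ : ℝ → Plane) (u : ℝ) : ℝ :=
  det2 (p (tangentParam γ u)) (deriv p (tangentParam γ u)) * (angularRate γ u / speedQ P γ u)

/-- The integral `∫ k² ds` over the closed curve `γ` of period `T`, with `ds = v du`. -/
def curvatureSqIntegral (P : Set Plane) (p γ : ℝ → Plane) (T : ℝ) : ℝ :=
  ∫ u in (0 : ℝ)..T, curvature P p γ u ^ 2 * speedQ P γ u

/-- The curve `γ` is a `P`-circle: its trace is a circle of positive radius for the norm with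
unit ball `P`. -/
def IsPCircle (P : Set Plane) (γ : ℝ → Plane) : Prop :=
  ∃ (c : Plane) (r : ℝ), 0 < r ∧ Set.range γ = {x | gauge P (x - c) = r}

end MinkowskiPlane

end

/-! Let `a` and `ρ` be the support function and radius of curvature of `P`, `α` its area, `σ` the
Euclidean speed of `γ`, `κ` its turning rate, and `g` its support function about a point `c`, all
read at the tangent angle. Then `ds = a σ du` and `k = ρ κ / σ`. Symmetry of the mixed area gives `∫
(g/a) k ds = ∫ g ρ κ du = ∫ a σ du = L`. By Cauchy–Schwarz it therefore suffices to find `c` with `α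
∫ (g/a)² ds ≤ A L`.

For a centrally symmetric curve this follows from a Bonnesen inequality: every ratio `r = g/a`
satisfies `A - r L + α r² ≤ 0`, and integrating this against `ds` gives the bound. The Bonnesen
inequality is Wirtinger's inequality `∫ f (f + f'') dθ ≤ 0` over a half turn for `f = g - r a`,
which takes equal values at the two ends and has a zero (`wirtinger_half_turn`,
`IsSupportData.bonnesen`).

A general curve is cut by a chord that joins points with opposite tangents and bisects the area
(`exists_bisecting_chord`). With `c` the midpoint of the chord, each arc together with its
reflection in `c` is a symmetric curve enclosing area `A`. The bounds for the two arcs add up.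

In case of equality, all ratios on an arc are roots of one quadratic polynomial. By continuity `g/a`
is then constant, so `γ` is a `P`-circle. -/

namespace MinkowskiPlane

/-! ### The rotating frame -/

/-- The component of `x` along the unit vector `(cos θ, sin θ)`. -/
noncomputable def normalPart (x : Plane) (θ : ℝ) : ℝ := x 0 * Real.cos θ + x 1 * Real.sin θ

/-- The component of `x` along `e_θ`. -/
noncomputable def tangentPart (x : Plane) (θ : ℝ) : ℝ := -x 0 * Real.sin θ + x 1 * Real.cos θ

@[simp] lemma eTheta_zero (θ : ℝ) : eTheta θ 0 = -Real.sin θ := rfl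
@[simp] lemma eTheta_one (θ : ℝ) : eTheta θ 1 = Real.cos θ := rfl

lemma det2_eTheta (x : Plane) (θ : ℝ) : det2 x (eTheta θ) = normalPart x θ := by
  simp [det2, normalPart]

lemma plane_ext {x y : Plane} (h0 : x 0 = y 0) (h1 : x 1 = y 1) : x = y := by
  ext i; fin_cases i <;> assumption

lemma ext_of_parts {x y : Plane} {θ : ℝ} (hN : normalPart x θ = normalPart y θ)
    (hT : tangentPart x θ = tangentPart y θ) : x = y := by
  unfold normalPart at hN
  unfold tangentPart at hT
  have h := Real.sin_sq_add_cos_sq θ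
  apply plane_ext
  · linear_combination Real.cos θ * hN - Real.sin θ * hT + (y 0 - x 0) * h
  · linear_combination Real.sin θ * hN + Real.cos θ * hT + (y 1 - x 1) * h

lemma normalPart_add (x y : Plane) (θ : ℝ) :
    normalPart (x + y) θ = normalPart x θ + normalPart y θ := by
  simp [normalPart]; ring

lemma normalPart_sub (x y : Plane) (θ : ℝ) :
    normalPart (x - y) θ = normalPart x θ - normalPart y θ := by
  simp [normalPart]; ring

lemma normalPart_smul (c : ℝ) (x : Plane) (θ : ℝ) :
    normalPart (c • x) θ = c * normalPart x θ := by
  simp [normalPart]; ring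

lemma normalPart_neg (x : Plane) (θ : ℝ) : normalPart (-x) θ = -normalPart x θ := by
  simp [normalPart]; ring

lemma tangentPart_smul (c : ℝ) (x : Plane) (θ : ℝ) :
    tangentPart (c • x) θ = c * tangentPart x θ := by
  simp [tangentPart]; ring

lemma tangentPart_neg (x : Plane) (θ : ℝ) : tangentPart (-x) θ = -tangentPart x θ := by
  simp [tangentPart]; ring

lemma normalPart_add_pi (x : Plane) (θ : ℝ) :
    normalPart x (θ + Real.pi) = -normalPart x θ := by
  simp [normalPart]; ring

lemma tangentPart_add_pi (x : Plane) (θ : ℝ) :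
    tangentPart x (θ + Real.pi) = -tangentPart x θ := by
  simp [tangentPart]; ring

lemma normalPart_add_two_pi (x : Plane) (θ : ℝ) :
    normalPart x (θ + 2 * Real.pi) = normalPart x θ := by
  simp [normalPart]

lemma normalPart_eTheta (θ : ℝ) : normalPart (eTheta θ) θ = 0 := by
  simp [normalPart]; ring

lemma tangentPart_eTheta (θ : ℝ) : tangentPart (eTheta θ) θ = 1 := by
  simp [tangentPart]; linear_combination Real.sin_sq_add_cos_sq θ

lemma normalPart_eTheta_of (t θ : ℝ) : normalPart (eTheta t) θ = -Real.sin (t - θ) := by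
  simp [normalPart, Real.sin_sub]; ring

lemma eTheta_add_pi (θ : ℝ) : eTheta (θ + Real.pi) = -eTheta θ := by
  apply plane_ext <;> simp

lemma eTheta_add_two_pi (θ : ℝ) : eTheta (θ + 2 * Real.pi) = eTheta θ := by
  apply plane_ext <;> simp

lemma eTheta_eq_iff {s t : ℝ} (h : eTheta s = eTheta t) : ∃ n : ℤ, s = t + n * (2 * Real.pi) := by
  have h0 := congrArg (fun x : Plane => x 0) h
  have h1 := congrArg (fun x : Plane => x 1) h
  simp only [eTheta_zero, eTheta_one, neg_inj] at h0 h1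
  obtain ⟨n, hn⟩ := (Real.Angle.angle_eq_iff_two_pi_dvd_sub).1 (Real.Angle.cos_sin_inj h1 h0)
  exact ⟨n, by linarith⟩

lemma det2_smul_right (c : ℝ) (x y : Plane) : det2 x (c • y) = c * det2 x y := by
  simp [det2]; ring

lemma det2_sub_left (x y z : Plane) : det2 (x - y) z = det2 x z - det2 y z := by
  simp [det2]; ring

lemma continuous_det2 {α : Type*} [TopologicalSpace α] {f g : α → Plane} (hf : Continuous f)
    (hg : Continuous g) : Continuous fun x => det2 (f x) (g x) := by
  unfold det2; fun_prop

lemma continuous_normalPart {α : Type*} [TopologicalSpace α] {f : α → Plane} {θ : α → ℝ}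
    (hf : Continuous f) (hθ : Continuous θ) : Continuous fun x => normalPart (f x) (θ x) := by
  unfold normalPart; fun_prop

lemma continuous_tangentPart {α : Type*} [TopologicalSpace α] {f : α → Plane} {θ : α → ℝ}
    (hf : Continuous f) (hθ : Continuous θ) : Continuous fun x => tangentPart (f x) (θ x) := by
  unfold tangentPart; fun_prop

lemma hasDerivAt_coord {f : ℝ → Plane} {f' : Plane} {u : ℝ} (hf : HasDerivAt f f' u)
    (i : Fin 2) : HasDerivAt (fun u => f u i) (f' i) u :=
  (EuclideanSpace.proj (𝕜 := ℝ) i).hasFDerivAt.comp_hasDerivAt u hf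

lemma hasDerivAt_normalPart {f : ℝ → Plane} {f' : Plane} {θ : ℝ → ℝ} {κ u : ℝ}
    (hf : HasDerivAt f f' u) (hθ : HasDerivAt θ κ u) :
    HasDerivAt (fun u => normalPart (f u) (θ u))
      (normalPart f' (θ u) + κ * tangentPart (f u) (θ u)) u := by
  have h := ((hasDerivAt_coord hf 0).mul hθ.cos).add ((hasDerivAt_coord hf 1).mul hθ.sin)
  refine h.congr_deriv ?_
  simp only [normalPart, tangentPart]; ring

lemma hasDerivAt_tangentPart {f : ℝ → Plane} {f' : Plane} {θ : ℝ → ℝ} {κ u : ℝ}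
    (hf : HasDerivAt f f' u) (hθ : HasDerivAt θ κ u) :
    HasDerivAt (fun u => tangentPart (f u) (θ u))
      (tangentPart f' (θ u) - κ * normalPart (f u) (θ u)) u := by
  have h := ((hasDerivAt_coord hf 0).fun_neg.mul hθ.sin).add ((hasDerivAt_coord hf 1).mul hθ.cos)
  refine h.congr_deriv ?_
  simp only [tangentPart, normalPart]; ring

/-! ### Support function, central symmetry and dual norm of the unit ball -/

namespace IsUnitBall

variable {P : Set Plane} {p : ℝ → Plane}

lemma hasDerivAt (hP : IsUnitBall P p) (θ : ℝ) : HasDerivAt p (deriv p θ) θ :=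
  (hP.smooth.differentiable (by simp) θ).hasDerivAt

lemma continuous_deriv (hP : IsUnitBall P p) : Continuous (deriv p) :=
  hP.smooth.continuous_deriv (by simp)

/-- The radius of curvature of the boundary of the unit ball. -/
noncomputable def radius (p : ℝ → Plane) (θ : ℝ) : ℝ := tangentPart (deriv p θ) θ

lemma deriv_eq_radius (hP : IsUnitBall P p) (θ : ℝ) : deriv p θ = radius p θ • eTheta θ := by
  obtain ⟨c, -, hc⟩ := hP.deriv_eq θ
  rw [radius, hc, tangentPart_smul, tangentPart_eTheta, mul_one]

lemma radius_pos (hP : IsUnitBall P p) (θ : ℝ) : 0 < radius p θ := by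
  obtain ⟨c, h, hc⟩ := hP.deriv_eq θ
  rwa [radius, hc, tangentPart_smul, tangentPart_eTheta, mul_one]

lemma continuous_radius (hP : IsUnitBall P p) : Continuous (radius p) :=
  continuous_tangentPart hP.continuous_deriv continuous_id

lemma hasDerivAt_support (hP : IsUnitBall P p) (θ : ℝ) :
    HasDerivAt (fun θ => normalPart (p θ) θ) (tangentPart (p θ) θ) θ := by
  refine (hasDerivAt_normalPart (hP.hasDerivAt θ) (hasDerivAt_id θ)).congr_deriv ?_
  rw [hP.deriv_eq_radius, normalPart_smul]
  simp [normalPart_eTheta]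

lemma hasDerivAt_tangentPart (hP : IsUnitBall P p) (θ : ℝ) :
    HasDerivAt (fun θ => tangentPart (p θ) θ) (radius p θ - normalPart (p θ) θ) θ := by
  refine (MinkowskiPlane.hasDerivAt_tangentPart (hP.hasDerivAt θ) (hasDerivAt_id θ)).congr_deriv ?_
  simp [radius]

/-- As `p' t` is a positive multiple of `e_t`, the height of `p t` in a fixed direction `θ` rises
for `t` in `[θ - π, θ]` and falls in `[θ, θ + π]`. The comparisons of boundary points below rest on
this. -/
lemma hasDerivAt_normalPart_const (hP : IsUnitBall P p) (θ t : ℝ) :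
    HasDerivAt (fun t => normalPart (p t) θ) (-(radius p t * Real.sin (t - θ))) t := by
  refine (hasDerivAt_normalPart (hP.hasDerivAt t) (hasDerivAt_const t θ)).congr_deriv ?_
  rw [hP.deriv_eq_radius, normalPart_smul, normalPart_eTheta_of]
  ring

/-- The boundary point `p θ` is the only one of maximal height in the normal direction. -/
lemma normalPart_lt (hP : IsUnitBall P p) {θ t : ℝ} (h : p t ≠ p θ) :
    normalPart (p t) θ < normalPart (p θ) θ := by
  -- By periodicity `t` may be taken within a half turn of `θ`, where the height is monotone on each
  -- side.
  obtain ⟨n, hn, -⟩ := existsUnique_sub_zsmul_mem_Ico Real.two_pi_pos t (θ - Real.pi)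
  have hp : p (t - n • (2 * Real.pi)) = p t := hP.periodic.sub_zsmul_eq n
  rw [← hp] at h ⊢
  set s := t - n • (2 * Real.pi)
  have hc : ∀ S : Set ℝ, ContinuousOn (fun t => normalPart (p t) θ) S := fun S x _ =>
    (hP.hasDerivAt_normalPart_const θ x).continuousAt.continuousWithinAt
  rcases lt_trichotomy s θ with hs | hs | hs
  · have := strictMonoOn_of_deriv_pos (convex_Icc (θ - Real.pi) θ) (hc _) (fun x hx => by
      rw [interior_Icc] at hx
      rw [(hP.hasDerivAt_normalPart_const θ x).deriv, neg_pos]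
      exact mul_neg_of_pos_of_neg (hP.radius_pos x)
        (Real.sin_neg_of_neg_of_neg_pi_lt (by linarith [hx.2]) (by linarith [hx.1])))
    exact this ⟨hn.1, hs.le⟩ ⟨by linarith [Real.pi_pos], le_rfl⟩ hs
  · exact absurd (congrArg p hs) h
  · have := strictAntiOn_of_deriv_neg (convex_Icc θ (θ + Real.pi)) (hc _) (fun x hx => by
      rw [interior_Icc] at hx
      rw [(hP.hasDerivAt_normalPart_const θ x).deriv, neg_lt_zero]
      exact mul_pos (hP.radius_pos x)
        (Real.sin_pos_of_pos_of_lt_pi (by linarith [hx.1]) (by linarith [hx.2])))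
    exact this ⟨le_rfl, by linarith [Real.pi_pos]⟩ ⟨hs.le, by linarith [hn.2]⟩ hs

lemma normalPart_le (hP : IsUnitBall P p) (θ t : ℝ) :
    normalPart (p t) θ ≤ normalPart (p θ) θ := by
  by_cases h : p t = p θ
  · rw [h]
  · exact (hP.normalPart_lt h).le

/-- Not an instance of `normalPart_lt`: that `p (θ + π)` and `p θ` differ is a consequence, by
strict monotonicity over the half turn. -/
lemma normalPart_add_pi_lt (hP : IsUnitBall P p) (θ : ℝ) :
    normalPart (p (θ + Real.pi)) θ < normalPart (p θ) θ := by
  have := strictAntiOn_of_deriv_neg (convex_Icc θ (θ + Real.pi))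
    (fun x _ => (hP.hasDerivAt_normalPart_const θ x).continuousAt.continuousWithinAt)
    (fun x hx => by
      rw [interior_Icc] at hx
      rw [(hP.hasDerivAt_normalPart_const θ x).deriv, neg_lt_zero]
      exact mul_pos (hP.radius_pos x)
        (Real.sin_pos_of_pos_of_lt_pi (by linarith [hx.1]) (by linarith [hx.2])))
  exact this ⟨le_rfl, by linarith [Real.pi_pos]⟩ ⟨by linarith [Real.pi_pos], le_rfl⟩
    (by linarith [Real.pi_pos])

lemma injOn (hP : IsUnitBall P p) : Set.InjOn p (Set.Ico 0 (2 * Real.pi)) := by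
  have key : ∀ s t : ℝ, 0 ≤ s → s < t → t < 2 * Real.pi → p s ≠ p t := by
    intro s t hs hst ht heq
    have hc : ∀ S : Set ℝ, ContinuousOn (fun t => normalPart (p t) s) S := fun S x _ =>
      (hP.hasDerivAt_normalPart_const s x).continuousAt.continuousWithinAt
    rcases le_total t (s + Real.pi) with h | h
    · have := strictAntiOn_of_deriv_neg (convex_Icc s (s + Real.pi)) (hc _) (fun x hx => by
        rw [interior_Icc] at hx
        rw [(hP.hasDerivAt_normalPart_const s x).deriv, neg_lt_zero]
        exact mul_pos (hP.radius_pos x)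
          (Real.sin_pos_of_pos_of_lt_pi (by linarith [hx.1]) (by linarith [hx.2])))
      have := this ⟨le_rfl, by linarith [Real.pi_pos]⟩ ⟨hst.le, h⟩ hst
      simp only [heq, lt_self_iff_false] at this
    · have := strictMonoOn_of_deriv_pos (convex_Icc (s + Real.pi) (s + 2 * Real.pi)) (hc _)
        (fun x hx => by
        rw [interior_Icc] at hx
        rw [(hP.hasDerivAt_normalPart_const s x).deriv, neg_pos, ← Real.sin_sub_two_pi]
        exact mul_neg_of_pos_of_neg (hP.radius_pos x)
          (Real.sin_neg_of_neg_of_neg_pi_lt (by linarith [hx.2]) (by linarith [hx.1])))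
      have := this ⟨h, by linarith⟩ ⟨by linarith, le_rfl⟩ (show t < s + 2 * Real.pi by linarith)
      simp only [hP.periodic s, heq, lt_self_iff_false] at this
  intro s hs t ht heq
  by_contra hne
  rcases lt_or_gt_of_ne hne with h | h
  · exact key s t hs.1 h ht.2 heq
  · exact key t s ht.1 h hs.2 heq.symm

lemma neg_mem_frontier (hP : IsUnitBall P p) {x : Plane} (hx : x ∈ frontier P) :
    -x ∈ frontier P := by
  have hneg : -P = P := by
    ext y
    exact ⟨fun h => by simpa using hP.symmetric _ h, fun h => hP.symmetric _ h⟩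
  have h : (Homeomorph.neg Plane) ⁻¹' frontier P = frontier P := by
    rw [(Homeomorph.neg Plane).preimage_frontier]
    congr 1
  rw [← h] at hx
  exact hx

/-- The point `p (θ + π)` is the unique lowest boundary point in direction `θ`, and central symmetry
carries the highest point `p θ` to the lowest. -/
lemma apply_add_pi (hP : IsUnitBall P p) (θ : ℝ) : p (θ + Real.pi) = -p θ := by
  have hm : -p θ ∈ Set.range p := by
    rw [hP.range_eq]
    exact hP.neg_mem_frontier (hP.range_eq ▸ Set.mem_range_self θ)
  have hm' : -p (θ + Real.pi) ∈ Set.range p := by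
    rw [hP.range_eq]
    exact hP.neg_mem_frontier (hP.range_eq ▸ Set.mem_range_self _)
  obtain ⟨t, ht⟩ := hm
  obtain ⟨s, hs⟩ := hm'
  by_contra hne
  have h1 : p t ≠ p (θ + Real.pi) := by rw [ht]; exact fun h => hne h.symm
  have h2 := hP.normalPart_lt h1
  have h3 := hP.normalPart_le θ s
  rw [ht, normalPart_add_pi, normalPart_add_pi, normalPart_neg] at h2
  rw [hs, normalPart_neg] at h3
  linarith

lemma support_pos (hP : IsUnitBall P p) (θ : ℝ) : 0 < normalPart (p θ) θ := by
  have := hP.normalPart_add_pi_lt θ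
  rw [hP.apply_add_pi, normalPart_neg] at this
  linarith

lemma support_add_pi (hP : IsUnitBall P p) (θ : ℝ) :
    normalPart (p (θ + Real.pi)) (θ + Real.pi) = normalPart (p θ) θ := by
  rw [hP.apply_add_pi, normalPart_neg, normalPart_add_pi, neg_neg]

lemma tangentPart_add_pi (hP : IsUnitBall P p) (θ : ℝ) :
    tangentPart (p (θ + Real.pi)) (θ + Real.pi) = tangentPart (p θ) θ := by
  rw [hP.apply_add_pi, tangentPart_neg, MinkowskiPlane.tangentPart_add_pi, neg_neg]

lemma radius_add_pi (hP : IsUnitBall P p) (θ : ℝ) : radius p (θ + Real.pi) = radius p θ := by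
  have h : deriv p (θ + Real.pi) = -deriv p θ := by
    rw [← deriv_comp_add_const, ← deriv.fun_neg]
    congr 1
    exact funext hP.apply_add_pi
  rw [radius, h, tangentPart_neg, MinkowskiPlane.tangentPart_add_pi, neg_neg, radius]

lemma det2_deriv (hP : IsUnitBall P p) (θ : ℝ) :
    det2 (p θ) (deriv p θ) = normalPart (p θ) θ * radius p θ := by
  rw [hP.deriv_eq_radius, det2_smul_right, det2_eTheta, mul_comm]

lemma mem (hP : IsUnitBall P p) (θ : ℝ) : p θ ∈ P :=
  hP.isCompact.isClosed.frontier_subset (hP.range_eq ▸ Set.mem_range_self θ)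

/-- The centre is the midpoint of `p 0` and `-p 0`. It is no boundary point, since each `p θ` has
positive height in direction `θ`. -/
lemma zero_mem_interior (hP : IsUnitBall P p) : (0 : Plane) ∈ interior P := by
  have h0 : (0 : Plane) ∈ P := by
    have := hP.strictConvex.convex (hP.mem 0) (hP.symmetric _ (hP.mem 0))
      (by norm_num : (0 : ℝ) ≤ 1 / 2) (by norm_num : (0 : ℝ) ≤ 1 / 2) (by norm_num)
    simpa using this
  by_contra h
  have hf : (0 : Plane) ∈ frontier P := ⟨subset_closure h0, h⟩
  rw [← hP.range_eq] at hf
  obtain ⟨θ, hθ⟩ := hf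
  have := hP.support_pos θ
  rw [hθ] at this
  simp [normalPart] at this

lemma gauge_eq_one_iff (hP : IsUnitBall P p) {x : Plane} : gauge P x = 1 ↔ x ∈ Set.range p := by
  rw [hP.range_eq]
  exact gauge_eq_one_iff_mem_frontier hP.strictConvex.convex
    (mem_interior_iff_mem_nhds.1 hP.zero_mem_interior)

/-- The half-planes bounded by the tangent lines contain the unit ball. -/
lemma normalPart_le_of_mem (hP : IsUnitBall P p) (θ : ℝ) {w : Plane} (hw : w ∈ P) :
    normalPart w θ ≤ normalPart (p θ) θ := by
  obtain ⟨x, hx, hmax⟩ := hP.isCompact.exists_isMaxOn ⟨w, hw⟩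
    (continuous_normalPart continuous_id (continuous_const (y := θ))).continuousOn
  have hxf : x ∈ frontier P := by
    -- An interior maximizer could be moved a little in the direction `(cos θ, sin θ)`, raising its
    -- height.
    refine ⟨subset_closure hx, fun hi => ?_⟩
    have hcont : Continuous fun t : ℝ => x + t • (!₂[Real.cos θ, Real.sin θ] : Plane) := by
      fun_prop
    have hev : ∀ᶠ t : ℝ in nhds 0, x + t • (!₂[Real.cos θ, Real.sin θ] : Plane) ∈ P :=
      hcont.continuousAt.eventually (by simpa using mem_interior_iff_mem_nhds.1 hi)
    obtain ⟨ε, hε, hball⟩ := Metric.eventually_nhds_iff.1 hev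
    have h1 := hmax (hball (y := ε / 2) (by
      rw [Real.dist_eq, sub_zero, abs_of_pos (by linarith)]; linarith))
    simp only [id, Set.mem_ofPred_eq, normalPart_add, normalPart_smul] at h1
    have h2 : normalPart (!₂[Real.cos θ, Real.sin θ] : Plane) θ = 1 := by
      simp [normalPart]; linear_combination Real.sin_sq_add_cos_sq θ
    rw [h2] at h1
    linarith
  rw [← hP.range_eq] at hxf
  obtain ⟨t, rfl⟩ := hxf
  exact (hmax hw).trans (hP.normalPart_le θ t)

/-- Since `[w, e_θ]` is the height of `w` in direction `θ`, the dual norm of `e_θ` is the largest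
absolute height on `P`, which is attained at `p θ`. -/
lemma gauge_dualBall (hP : IsUnitBall P p) {c : ℝ} (hc : 0 < c) (θ : ℝ) :
    gauge (dualBall P) (c • eTheta θ) = c * normalPart (p θ) θ := by
  have hpos : 0 < c * normalPart (p θ) θ := mul_pos hc (hP.support_pos θ)
  have hset : {r ∈ Set.Ioi (0 : ℝ) | r⁻¹ • (c • eTheta θ) ∈ dualBall P} =
      Set.Ici (c * normalPart (p θ) θ) := by
    ext r
    simp only [Set.mem_ofPred_eq, Set.mem_Ioi, Set.mem_Ici, dualBall, det2_smul_right, det2_eTheta]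
    constructor
    · rintro ⟨hr, h⟩
      have := (le_abs_self _).trans (h _ (hP.mem θ))
      rwa [inv_mul_le_iff₀ hr, mul_one] at this
    · intro h
      have hr : 0 < r := hpos.trans_le h
      refine ⟨hr, fun w hw => ?_⟩
      have h1 := hP.normalPart_le_of_mem θ hw
      have h2 := hP.normalPart_le_of_mem θ (hP.symmetric w hw)
      rw [normalPart_neg] at h2
      rw [abs_mul, abs_of_pos (inv_pos.2 hr), inv_mul_le_iff₀ hr, mul_one, abs_mul, abs_of_pos hc]
      exact (mul_le_mul_of_nonneg_left (abs_le.2 ⟨by linarith, h1⟩) hc.le).trans h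
  rw [gauge_def', hset, csInf_Ici]

end IsUnitBall
end MinkowskiPlane

/-! ### Wirtinger's inequality over a half turn -/

section

open intervalIntegral

namespace MinkowskiPlane

/-- The cotangent form of the Wirtinger inequality, on an interval on which `f` vanishes at one
end: `F = f n - f ^ 2 cot (θ - θ φ)` has derivative at least `f (n' + θ' f)`. -/
lemma wirtinger_boundary_hasDerivAt {f n n' θ κ : ℝ → ℝ} {φ u : ℝ}
    (hf : HasDerivAt f (κ u * n u) u) (hn : HasDerivAt n (n' u) u) (hθ : HasDerivAt θ (κ u) u)
    (hs : Real.sin (θ u - θ φ) ≠ 0) :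
    HasDerivAt
      (fun u => f u * n u - f u ^ 2 * (Real.cos (θ u - θ φ) / Real.sin (θ u - θ φ)))
      (f u * (n' u + κ u * f u) +
        κ u * (n u - f u * (Real.cos (θ u - θ φ) / Real.sin (θ u - θ φ))) ^ 2) u := by
  have hψ : HasDerivAt (fun u => θ u - θ φ) (κ u) u := hθ.sub_const _
  have h := (hf.mul hn).sub ((hf.pow 2).mul (hψ.cos.div hψ.sin hs))
  refine h.congr_deriv ?_
  -- The derivative of `cot` is `-1 - cot²`: the `1` yields the term `κ f²`, and `cot²` completes
  -- the square.
  simp only [Pi.pow_apply, Pi.div_apply]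
  field_simp
  ring

/-- `f ^ 2 cot (θ - θ φ)` is continuous at a zero `φ` of `f` when `f' = O(θ')`. -/
lemma wirtinger_boundary_continuousAt {f n θ κ : ℝ → ℝ} {φ u₀ u₁ : ℝ}
    (hf : ∀ u, HasDerivAt f (κ u * n u) u) (hn : Continuous n)
    (hθ : ∀ u, HasDerivAt θ (κ u) u) (hκ0 : ∀ u, 0 ≤ κ u)
    (hφ : φ ∈ Set.Ioo u₀ u₁) (hzero : f φ = 0) :
    ContinuousAt
      (fun u => f u * n u - f u ^ 2 * (Real.cos (θ u - θ φ) / Real.sin (θ u - θ φ))) φ := by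
  have hfc : Continuous f := continuous_iff_continuousAt.2 fun u => (hf u).continuousAt
  have hθc : Continuous θ := continuous_iff_continuousAt.2 fun u => (hθ u).continuousAt
  obtain ⟨C, hC⟩ := (isCompact_Icc (a := u₀) (b := u₁)).exists_bound_of_continuousOn hn.continuousOn
  have hC0 : 0 ≤ C := (norm_nonneg _).trans (hC φ ⟨hφ.1.le, hφ.2.le⟩)
  -- `C θ ± f` is monotone on the interval
  have hmono : ∀ ε : ℝ, |ε| = 1 → MonotoneOn (fun u => C * θ u + ε * f u) (Set.Icc u₀ u₁) := by
    intro ε hε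
    refine monotoneOn_of_deriv_nonneg (convex_Icc _ _) (by fun_prop) ?_ ?_
    · intro u _
      exact (((hθ u).const_mul C).add ((hf u).const_mul ε)).differentiableAt.differentiableWithinAt
    · intro u hu
      rw [interior_Icc] at hu
      have hd := (((hθ u).const_mul C).add ((hf u).const_mul ε)).deriv
      have : deriv (fun u => C * θ u + ε * f u) u = C * κ u + ε * (κ u * n u) := hd
      rw [this]
      have h1 : |ε * n u| ≤ C := by
        rw [abs_mul, hε, one_mul]; exact hC u ⟨hu.1.le, hu.2.le⟩
      nlinarith [hκ0 u, (abs_le.1 h1).1]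
  have hbound : ∀ u ∈ Set.Icc u₀ u₁, |f u| ≤ C * |θ u - θ φ| := by
    intro u hu
    have hφ' : φ ∈ Set.Icc u₀ u₁ := ⟨hφ.1.le, hφ.2.le⟩
    have e1 := hmono 1 (by simp)
    have e2 := hmono (-1) (by simp)
    rcases le_total u φ with h | h
    · have a1 := e1 hu hφ' h
      have a2 := e2 hu hφ' h
      simp only [hzero] at a1 a2
      rw [abs_le]
      have := neg_abs_le (θ u - θ φ)
      constructor <;> nlinarith
    · have a1 := e1 hφ' hu h
      have a2 := e2 hφ' hu h
      simp only [hzero] at a1 a2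
      rw [abs_le]
      have := le_abs_self (θ u - θ φ)
      constructor <;> nlinarith
  have hψ : Filter.Tendsto (fun u => θ u - θ φ) (nhds φ) (nhds 0) := by
    have : ContinuousAt (fun u => θ u - θ φ) φ := by fun_prop
    simpa [ContinuousAt] using this
  have hsin : ∀ᶠ u in nhds φ, |θ u - θ φ| ≤ 2 * |Real.sin (θ u - θ φ)| := by
    have h1 : ∀ᶠ x : ℝ in nhds 0, |x| ≤ 1 := by
      filter_upwards [Metric.ball_mem_nhds (0 : ℝ) one_pos] with x hx
      rw [Metric.mem_ball, Real.dist_eq, sub_zero] at hx; exact hx.le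
    filter_upwards [hψ.eventually h1] with u hu
    have h2 := Real.mul_abs_le_abs_sin (x := θ u - θ φ) (by linarith [Real.pi_gt_three])
    have h3 : 1 / 2 ≤ 2 / Real.pi := by
      rw [div_le_div_iff₀ (by norm_num) Real.pi_pos]; linarith [Real.pi_le_four]
    nlinarith [abs_nonneg (θ u - θ φ)]
  -- From `|f| ≤ C |ψ| ≤ 2 C |sin ψ|` with `ψ = θ - θ φ` one gets `|f² cot ψ| ≤ 2 C |f|`, which
  -- tends to `0`.
  have hlim : Filter.Tendsto
      (fun u => f u ^ 2 * (Real.cos (θ u - θ φ) / Real.sin (θ u - θ φ))) (nhds φ) (nhds 0) := by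
    have hg : Filter.Tendsto (fun u => 2 * C * |f u|) (nhds φ) (nhds 0) := by
      have : ContinuousAt (fun u => 2 * C * |f u|) φ := by fun_prop
      simpa [ContinuousAt, hzero] using this
    refine squeeze_zero_norm' ?_ hg
    filter_upwards [hsin, Icc_mem_nhds hφ.1 hφ.2] with u hu hI
    rw [Real.norm_eq_abs, abs_mul, abs_pow, abs_div]
    by_cases hz : Real.sin (θ u - θ φ) = 0
    · rw [hz]; simp; positivity
    · have hz' : 0 < |Real.sin (θ u - θ φ)| := abs_pos.2 hz
      rw [← mul_div_assoc, div_le_iff₀ hz']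
      have hc := Real.abs_cos_le_one (θ u - θ φ)
      have hb := hbound u hI
      calc |f u| ^ 2 * |Real.cos (θ u - θ φ)| ≤ |f u| ^ 2 * 1 := by gcongr
        _ = |f u| * |f u| := by ring
        _ ≤ |f u| * (C * (2 * |Real.sin (θ u - θ φ)|)) := by gcongr; exact hb.trans (by gcongr)
        _ = 2 * C * |f u| * |Real.sin (θ u - θ φ)| := by ring
  have h1 : ContinuousAt (fun u => f u * n u) φ := by fun_prop
  have h2 : ContinuousAt
      (fun u => f u ^ 2 * (Real.cos (θ u - θ φ) / Real.sin (θ u - θ φ))) φ := by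
    simpa [ContinuousAt, hzero] using hlim
  exact h1.sub h2

/-- Wirtinger's inequality over a half turn of the angle `θ`, for a function `f` with periodic
boundary values and a zero. -/
theorem wirtinger_half_turn {f n n' θ κ : ℝ → ℝ} {φ u₀ u₁ : ℝ}
    (hf : ∀ u, HasDerivAt f (κ u * n u) u) (hn : ∀ u, HasDerivAt n (n' u) u)
    (hn' : Continuous n') (hθ : ∀ u, HasDerivAt θ (κ u) u) (hκ : Continuous κ)
    (hκ0 : ∀ u, 0 ≤ κ u) (hmono : StrictMono θ) (hturn : θ u₁ = θ u₀ + Real.pi)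
    (hf01 : f u₁ = f u₀) (hn01 : n u₁ = n u₀)
    (hφ : φ ∈ Set.Ioo u₀ u₁) (hzero : f φ = 0) :
    ∫ u in u₀..u₁, f u * (n' u + κ u * f u) ≤ 0 := by
  have hfc : Continuous f := continuous_iff_continuousAt.2 fun u => (hf u).continuousAt
  have hnc : Continuous n := continuous_iff_continuousAt.2 fun u => (hn u).continuousAt
  set F : ℝ → ℝ := fun u =>
    f u * n u - f u ^ 2 * (Real.cos (θ u - θ φ) / Real.sin (θ u - θ φ)) with hF
  set G : ℝ → ℝ := fun u => f u * (n' u + κ u * f u) with hG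
  have hGc : Continuous G := by fun_prop
  have hsin : ∀ u ∈ Set.Icc u₀ u₁, u ≠ φ → Real.sin (θ u - θ φ) ≠ 0 := by
    intro u hu hne
    rcases lt_or_gt_of_ne hne with h | h
    · have h1 := hmono h
      have h2 := hmono hφ.2
      have h3 := hmono.monotone hu.1
      exact (Real.sin_neg_of_neg_of_neg_pi_lt (by linarith) (by linarith)).ne
    · have h1 := hmono h
      have h2 := hmono hφ.1
      have h3 := hmono.monotone hu.2
      exact (Real.sin_pos_of_pos_of_lt_pi (by linarith) (by linarith)).ne'
  have hder : ∀ u ∈ Set.Icc u₀ u₁, u ≠ φ → ∃ d, HasDerivAt F d u ∧ G u ≤ d := by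
    intro u hu hne
    refine ⟨_, wirtinger_boundary_hasDerivAt (hf u) (hn u) (hθ u) (hsin u hu hne), ?_⟩
    have := mul_nonneg (hκ0 u)
      (sq_nonneg (n u - f u * (Real.cos (θ u - θ φ) / Real.sin (θ u - θ φ))))
    simp only [hG]
    linarith
  have hcont : ContinuousOn F (Set.Icc u₀ u₁) := by
    intro u hu
    by_cases hne : u = φ
    · rw [hne]
      exact (wirtinger_boundary_continuousAt hf hnc hθ hκ0 hφ hzero).continuousWithinAt
    · obtain ⟨d, hd, -⟩ := hder u hu hne
      exact hd.continuousAt.continuousWithinAt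
  have hint : ∀ u, HasDerivAt (fun u => ∫ x in u₀..u, G x) (G u) u := fun u =>
    hGc.integral_hasStrictDerivAt u₀ u |>.hasDerivAt
  have hic : Continuous fun u => ∫ x in u₀..u, G x :=
    continuous_iff_continuousAt.2 fun u => (hint u).continuousAt
  -- On either side of `φ` the function `F - ∫ G` has nonnegative derivative. Continuity at `φ` lets
  -- both intervals include that point, so the two comparisons can be chained.
  have hmonoH : ∀ x y, u₀ ≤ x → y ≤ u₁ → (∀ u ∈ Set.Ioo x y, u ≠ φ) →
      MonotoneOn (fun u => F u - (∫ x in u₀..u, G x)) (Set.Icc x y) := by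
    intro x y hx hy hne
    have hsub : Set.Icc x y ⊆ Set.Icc u₀ u₁ := Set.Icc_subset_Icc hx hy
    refine monotoneOn_of_deriv_nonneg (convex_Icc x y)
      ((hcont.mono hsub).sub hic.continuousOn) ?_ ?_
    · intro u hu
      rw [interior_Icc] at hu
      obtain ⟨d, hd, -⟩ := hder u (hsub (Set.Ioo_subset_Icc_self hu)) (hne u hu)
      exact (hd.sub (hint u)).differentiableAt.differentiableWithinAt
    · intro u hu
      rw [interior_Icc] at hu
      obtain ⟨d, hd, hle⟩ := hder u (hsub (Set.Ioo_subset_Icc_self hu)) (hne u hu)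
      have := (hd.sub (hint u)).deriv
      rw [show deriv (fun u => F u - (∫ x in u₀..u, G x)) u = d - G u from this]
      linarith
  have m1 := hmonoH u₀ φ le_rfl hφ.2.le (fun u hu => hu.2.ne)
    ⟨le_rfl, hφ.1.le⟩ ⟨hφ.1.le, le_rfl⟩ hφ.1.le
  have m2 := hmonoH φ u₁ hφ.1.le le_rfl (fun u hu => hu.1.ne')
    ⟨le_rfl, hφ.2.le⟩ ⟨hφ.2.le, le_rfl⟩ hφ.2.le
  -- The cotangent has period `π`, so the boundary terms cancel over a half turn.
  have hFe : F u₁ = F u₀ := by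
    simp only [hF, hf01, hn01, hturn, add_sub_right_comm, Real.cos_add_pi, Real.sin_add_pi,
      neg_div_neg_eq]
  simp only [hFe, integral_same] at m1 m2
  linarith

/-! ### Mixed area and Bonnesen's inequality over a half turn -/

/-- The support function `g` and its derivative `m` with respect to the tangent angle `θ`, along
a convex curve of speed `σ` and rate of turning `κ`. -/
structure IsSupportData (θ κ σ g m : ℝ → ℝ) : Prop where
  hasDerivAt_angle : ∀ u, HasDerivAt θ (κ u) u
  hasDerivAt_support : ∀ u, HasDerivAt g (κ u * m u) u
  hasDerivAt_tangent : ∀ u, HasDerivAt m (σ u - κ u * g u) u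
  continuous_rate : Continuous κ
  continuous_speed : Continuous σ
  rate_nonneg : ∀ u, 0 ≤ κ u
  speed_pos : ∀ u, 0 < σ u
  strictMono : StrictMono θ

/-- The area of the unit ball, as an integral over its boundary. -/
noncomputable def boundaryArea (p : ℝ → Plane) : ℝ :=
  (∫ t in (0 : ℝ)..2 * Real.pi, normalPart (p t) t * IsUnitBall.radius p t) / 2

namespace IsUnitBall

variable {P : Set Plane} {p : ℝ → Plane}

lemma continuous_support (hP : IsUnitBall P p) : Continuous fun t => normalPart (p t) t :=
  continuous_normalPart hP.smooth.continuous continuous_id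

lemma continuous_tangent (hP : IsUnitBall P p) : Continuous fun t => tangentPart (p t) t :=
  continuous_tangentPart hP.smooth.continuous continuous_id

/-- By central symmetry the integrand has period `π`, so a half turn carries half of the full
integral; this absorbs the factor `1 / 2` in `boundaryArea`. -/
lemma integral_half_turn (hP : IsUnitBall P p) (t : ℝ) :
    ∫ t in t..t + Real.pi, normalPart (p t) t * radius p t = boundaryArea p := by
  have hper : Function.Periodic (fun t => normalPart (p t) t * radius p t) Real.pi := fun t => by
    simp only [hP.support_add_pi, hP.radius_add_pi]
  have hc : Continuous fun t => normalPart (p t) t * radius p t :=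
    hP.continuous_support.mul hP.continuous_radius
  have h := integral_add_adjacent_intervals (hc.intervalIntegrable 0 Real.pi (μ := MeasureTheory.volume))
    (hc.intervalIntegrable Real.pi (2 * Real.pi))
  have h1 := hper.intervalIntegral_add_eq Real.pi 0
  have h2 := hper.intervalIntegral_add_eq t 0
  rw [← two_mul] at h1
  rw [boundaryArea, ← h, h1, h2, zero_add]
  ring

lemma boundaryArea_pos (hP : IsUnitBall P p) : 0 < boundaryArea p := by
  rw [← hP.integral_half_turn 0]
  refine intervalIntegral_pos_of_pos_on
    ((hP.continuous_support.mul hP.continuous_radius).intervalIntegrable _ _)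
    (fun t _ => mul_pos (hP.support_pos t) (hP.radius_pos t)) (by linarith [Real.pi_pos])

end IsUnitBall

namespace IsSupportData

variable {P : Set Plane} {p : ℝ → Plane} {θ κ σ g m : ℝ → ℝ} {u₀ u₁ : ℝ}

lemma continuous_angle (h : IsSupportData θ κ σ g m) : Continuous θ :=
  continuous_iff_continuousAt.2 fun u => (h.hasDerivAt_angle u).continuousAt

lemma continuous_support (h : IsSupportData θ κ σ g m) : Continuous g :=
  continuous_iff_continuousAt.2 fun u => (h.hasDerivAt_support u).continuousAt

lemma continuous_tangent (h : IsSupportData θ κ σ g m) : Continuous m :=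
  continuous_iff_continuousAt.2 fun u => (h.hasDerivAt_tangent u).continuousAt

lemma hasDerivAt_ball_support (hP : IsUnitBall P p) (h : IsSupportData θ κ σ g m) (u : ℝ) :
    HasDerivAt (fun u => normalPart (p (θ u)) (θ u)) (tangentPart (p (θ u)) (θ u) * κ u) u :=
  (hP.hasDerivAt_support (θ u)).comp u (h.hasDerivAt_angle u)

lemma hasDerivAt_ball_tangent (hP : IsUnitBall P p) (h : IsSupportData θ κ σ g m) (u : ℝ) :
    HasDerivAt (fun u => tangentPart (p (θ u)) (θ u))
      ((IsUnitBall.radius p (θ u) - normalPart (p (θ u)) (θ u)) * κ u) u :=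
  (hP.hasDerivAt_tangentPart (θ u)).comp u (h.hasDerivAt_angle u)

lemma integral_ball (hP : IsUnitBall P p) (h : IsSupportData θ κ σ g m)
    (hturn : θ u₁ = θ u₀ + Real.pi) :
    ∫ u in u₀..u₁, normalPart (p (θ u)) (θ u) * IsUnitBall.radius p (θ u) * κ u =
      boundaryArea p := by
  have := integral_comp_mul_deriv (a := u₀) (b := u₁) (fun u _ => h.hasDerivAt_angle u)
    h.continuous_rate.continuousOn (hP.continuous_support.mul hP.continuous_radius)
  rw [hturn] at this
  rw [← hP.integral_half_turn (θ u₀)]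
  exact this

/-- The two expressions for the mixed area agree. -/
lemma mixed_area (hP : IsUnitBall P p) (h : IsSupportData θ κ σ g m)
    (hturn : θ u₁ = θ u₀ + Real.pi) (hg : g u₁ = g u₀) (hm : m u₁ = m u₀) :
    ∫ u in u₀..u₁, g u * IsUnitBall.radius p (θ u) * κ u =
      ∫ u in u₀..u₁, normalPart (p (θ u)) (θ u) * σ u := by
  have hθ := h.continuous_angle
  have hgc := h.continuous_support
  have hκ := h.continuous_rate
  have hσ := h.continuous_speed
  have ha : Continuous fun u => normalPart (p (θ u)) (θ u) := hP.continuous_support.comp hθ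
  have hr : Continuous fun u => IsUnitBall.radius p (θ u) := hP.continuous_radius.comp hθ
  -- With `b = a'` the tangential part of `p`, the function `g b - m a` is a primitive of the
  -- difference of the integrands, and it takes the same value at both ends of the half turn.
  have hd : ∀ u, HasDerivAt
      (fun u => g u * tangentPart (p (θ u)) (θ u) - m u * normalPart (p (θ u)) (θ u))
      (g u * IsUnitBall.radius p (θ u) * κ u - normalPart (p (θ u)) (θ u) * σ u) u := fun u => by
    refine (((h.hasDerivAt_support u).mul (h.hasDerivAt_ball_tangent hP u)).sub
      ((h.hasDerivAt_tangent u).mul (h.hasDerivAt_ball_support hP u))).congr_deriv ?_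
    ring
  have hi := integral_eq_sub_of_hasDerivAt (a := u₀) (b := u₁) (fun u _ => hd u)
    (Continuous.intervalIntegrable (by fun_prop) _ _)
  rw [integral_sub (Continuous.intervalIntegrable (by fun_prop) _ _)
    (Continuous.intervalIntegrable (by fun_prop) _ _)] at hi
  rw [hturn, hP.tangentPart_add_pi, hP.support_add_pi, hg, hm] at hi
  linarith

/-- The Bonnesen inequality for the symmetric body bounded by a half turn of the curve and its
reflection: `r` is any ratio of the two support functions. -/
theorem bonnesen (hP : IsUnitBall P p) (h : IsSupportData θ κ σ g m)
    (hturn : θ u₁ = θ u₀ + Real.pi) (hg : g u₁ = g u₀) (hm : m u₁ = m u₀) {φ : ℝ}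
    (hφ : φ ∈ Set.Icc u₀ u₁) :
    (∫ u in u₀..u₁, g u * σ u)
      - 2 * (g φ / normalPart (p (θ φ)) (θ φ)) *
        (∫ u in u₀..u₁, normalPart (p (θ u)) (θ u) * σ u)
      + boundaryArea p * (g φ / normalPart (p (θ φ)) (θ φ)) ^ 2 ≤ 0 := by
  have hθ := h.continuous_angle
  have hgc := h.continuous_support
  have hκ := h.continuous_rate
  have hσ := h.continuous_speed
  have ha : Continuous fun u => normalPart (p (θ u)) (θ u) := hP.continuous_support.comp hθ
  have hr : Continuous fun u => IsUnitBall.radius p (θ u) := hP.continuous_radius.comp hθ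
  have hlt : u₀ < u₁ := h.strictMono.lt_iff_lt.1 (by rw [hturn]; linarith [Real.pi_pos])
  have hq : Continuous fun φ => g φ / normalPart (p (θ φ)) (θ φ) :=
    hgc.div ha fun u => (hP.support_pos _).ne'
  rw [← closure_Ioo hlt.ne] at hφ
  -- The left side is continuous in `φ`, so the endpoints, where Wirtinger's inequality is not
  -- directly available, follow from interior points.
  refine closure_minimal (s := Set.Ioo u₀ u₁) (t := {φ | (∫ u in u₀..u₁, g u * σ u)
      - 2 * (g φ / normalPart (p (θ φ)) (θ φ)) *
        (∫ u in u₀..u₁, normalPart (p (θ u)) (θ u) * σ u)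
      + boundaryArea p * (g φ / normalPart (p (θ φ)) (θ φ)) ^ 2 ≤ 0}) ?_
    (isClosed_le (by fun_prop) continuous_const) hφ
  intro φ hφ
  simp only [Set.mem_ofPred_eq]
  set r := g φ / normalPart (p (θ φ)) (θ φ) with hrdef
  -- Here `f = g - r a` vanishes at `φ` by the choice of `r`, and `n' + κ f = σ - r ρ κ`. The
  -- product expands into the area, the two forms of the mixed area, and `α r²`.
  have hw := wirtinger_half_turn (φ := φ) (u₀ := u₀) (u₁ := u₁)
    (f := fun u => g u - r * normalPart (p (θ u)) (θ u))
    (n := fun u => m u - r * tangentPart (p (θ u)) (θ u))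
    (n' := fun u => σ u - κ u * g u -
      r * ((IsUnitBall.radius p (θ u) - normalPart (p (θ u)) (θ u)) * κ u))
    (fun u => ((h.hasDerivAt_support u).sub
      ((h.hasDerivAt_ball_support hP u).const_mul r)).congr_deriv (by ring))
    (fun u => (h.hasDerivAt_tangent u).sub ((h.hasDerivAt_ball_tangent hP u).const_mul r))
    (by fun_prop) h.hasDerivAt_angle hκ h.rate_nonneg h.strictMono hturn
    (by simp only [hturn, hP.support_add_pi, hg])
    (by simp only [hturn, hP.tangentPart_add_pi, hm]) hφ
    (by rw [hrdef, div_mul_cancel₀ _ (hP.support_pos _).ne', sub_self])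
  have e1 := h.mixed_area hP hturn hg hm
  have e2 := h.integral_ball hP hturn
  have hsplit : ∀ u, (g u - r * normalPart (p (θ u)) (θ u)) * (σ u - κ u * g u -
      r * ((IsUnitBall.radius p (θ u) - normalPart (p (θ u)) (θ u)) * κ u) +
      κ u * (g u - r * normalPart (p (θ u)) (θ u))) =
      g u * σ u - r * (normalPart (p (θ u)) (θ u) * σ u) -
        r * (g u * IsUnitBall.radius p (θ u) * κ u) +
        r ^ 2 * (normalPart (p (θ u)) (θ u) * IsUnitBall.radius p (θ u) * κ u) := fun u => by ring
  simp only [hsplit] at hw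
  rw [integral_add (Continuous.intervalIntegrable (by fun_prop) _ _)
      (Continuous.intervalIntegrable (by fun_prop) _ _),
    integral_sub (Continuous.intervalIntegrable (by fun_prop) _ _)
      (Continuous.intervalIntegrable (by fun_prop) _ _),
    integral_sub (Continuous.intervalIntegrable (by fun_prop) _ _)
      (Continuous.intervalIntegrable (by fun_prop) _ _),
    integral_const_mul, integral_const_mul, integral_const_mul, e1, e2] at hw
  linarith

/-- The negated Bonnesen quadratic is integrated against `ds = a σ du`. As `(g/a) a σ = g σ`, its
middle term gives twice area times length, and its constant term takes one of these away. -/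
lemma integral_bonnesen (hP : IsUnitBall P p) (h : IsSupportData θ κ σ g m) :
    ∫ u in u₀..u₁, -((∫ u in u₀..u₁, g u * σ u)
      - 2 * (g u / normalPart (p (θ u)) (θ u)) *
        (∫ u in u₀..u₁, normalPart (p (θ u)) (θ u) * σ u)
      + boundaryArea p * (g u / normalPart (p (θ u)) (θ u)) ^ 2) *
        (normalPart (p (θ u)) (θ u) * σ u) =
    (∫ u in u₀..u₁, g u * σ u) * (∫ u in u₀..u₁, normalPart (p (θ u)) (θ u) * σ u) -
      boundaryArea p * ∫ u in u₀..u₁,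
        (g u / normalPart (p (θ u)) (θ u)) ^ 2 * (normalPart (p (θ u)) (θ u) * σ u) := by
  have hθ := h.continuous_angle
  have hgc := h.continuous_support
  have hσ := h.continuous_speed
  have ha : Continuous fun u => normalPart (p (θ u)) (θ u) := hP.continuous_support.comp hθ
  have hq : Continuous fun φ => g φ / normalPart (p (θ φ)) (θ φ) :=
    hgc.div ha fun u => (hP.support_pos _).ne'
  set A := ∫ u in u₀..u₁, g u * σ u with hA
  set l := ∫ u in u₀..u₁, normalPart (p (θ u)) (θ u) * σ u with hl
  have hsplit : ∀ u, -(A - 2 * (g u / normalPart (p (θ u)) (θ u)) * l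
      + boundaryArea p * (g u / normalPart (p (θ u)) (θ u)) ^ 2) *
        (normalPart (p (θ u)) (θ u) * σ u) =
      2 * l * (g u * σ u) - A * (normalPart (p (θ u)) (θ u) * σ u) -
        boundaryArea p * ((g u / normalPart (p (θ u)) (θ u)) ^ 2 *
          (normalPart (p (θ u)) (θ u) * σ u)) := fun u => by
    have h1 : g u = g u / normalPart (p (θ u)) (θ u) * normalPart (p (θ u)) (θ u) :=
      (div_mul_cancel₀ _ (hP.support_pos _).ne').symm
    linear_combination (-2 * l * σ u) * h1
  simp only [hsplit]
  rw [integral_sub (Continuous.intervalIntegrable (by fun_prop) _ _)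
      (Continuous.intervalIntegrable (by fun_prop) _ _),
    integral_sub (Continuous.intervalIntegrable (by fun_prop) _ _)
      (Continuous.intervalIntegrable (by fun_prop) _ _),
    integral_const_mul, integral_const_mul, integral_const_mul, ← hA, ← hl]
  ring

theorem integral_sq_le (hP : IsUnitBall P p) (h : IsSupportData θ κ σ g m)
    (hturn : θ u₁ = θ u₀ + Real.pi) (hg : g u₁ = g u₀) (hm : m u₁ = m u₀) :
    boundaryArea p * (∫ u in u₀..u₁,
        (g u / normalPart (p (θ u)) (θ u)) ^ 2 * (normalPart (p (θ u)) (θ u) * σ u)) ≤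
      (∫ u in u₀..u₁, g u * σ u) * ∫ u in u₀..u₁, normalPart (p (θ u)) (θ u) * σ u := by
  have hlt : u₀ < u₁ := h.strictMono.lt_iff_lt.1 (by rw [hturn]; linarith [Real.pi_pos])
  rw [← sub_nonneg, ← h.integral_bonnesen hP]
  refine integral_nonneg hlt.le fun u hu => mul_nonneg ?_
    (mul_pos (hP.support_pos _) (h.speed_pos u)).le
  have := h.bonnesen hP hturn hg hm hu
  linarith

/-- Equality makes a continuous nonnegative integrand vanish, so every ratio is a root of the same
quadratic. A continuous function on an interval with at most two values is constant. -/
theorem ratio_const_of_integral_sq_eq (hP : IsUnitBall P p) (h : IsSupportData θ κ σ g m)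
    (hturn : θ u₁ = θ u₀ + Real.pi) (hg : g u₁ = g u₀) (hm : m u₁ = m u₀)
    (heq : boundaryArea p * (∫ u in u₀..u₁,
        (g u / normalPart (p (θ u)) (θ u)) ^ 2 * (normalPart (p (θ u)) (θ u) * σ u)) =
      (∫ u in u₀..u₁, g u * σ u) * ∫ u in u₀..u₁, normalPart (p (θ u)) (θ u) * σ u)
    {φ : ℝ} (hφ : φ ∈ Set.Icc u₀ u₁) :
    g φ / normalPart (p (θ φ)) (θ φ) = g u₀ / normalPart (p (θ u₀)) (θ u₀) := by
  have hθ := h.continuous_angle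
  have hgc := h.continuous_support
  have hσ := h.continuous_speed
  have ha : Continuous fun u => normalPart (p (θ u)) (θ u) := hP.continuous_support.comp hθ
  have hq : Continuous fun φ => g φ / normalPart (p (θ φ)) (θ φ) :=
    hgc.div ha fun u => (hP.support_pos _).ne'
  have hlt : u₀ < u₁ := h.strictMono.lt_iff_lt.1 (by rw [hturn]; linarith [Real.pi_pos])
  have hint := h.integral_bonnesen hP (u₀ := u₀) (u₁ := u₁)
  rw [heq, sub_self] at hint
  have hB := fun φ hφ => h.bonnesen hP hturn hg hm (φ := φ) hφ
  set A := ∫ u in u₀..u₁, g u * σ u with hA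
  set l := ∫ u in u₀..u₁, normalPart (p (θ u)) (θ u) * σ u with hl
  have hα := hP.boundaryArea_pos
  have hroot : ∀ φ ∈ Set.Icc u₀ u₁, A - 2 * (g φ / normalPart (p (θ φ)) (θ φ)) * l
      + boundaryArea p * (g φ / normalPart (p (θ φ)) (θ φ)) ^ 2 = 0 := by
    intro φ hφ
    by_contra hne
    have hneg := lt_of_le_of_ne (hB φ hφ) hne
    refine hint.not_gt (integral_pos hlt (by fun_prop) (fun u hu => mul_nonneg ?_
      (mul_pos (hP.support_pos _) (h.speed_pos u)).le) ⟨φ, hφ, mul_pos (by linarith)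
      (mul_pos (hP.support_pos _) (h.speed_pos φ))⟩)
    have := hB u (Set.Ioc_subset_Icc_self hu)
    linarith
  have hsq : ∀ φ ∈ Set.Icc u₀ u₁,
      (boundaryArea p * (g φ / normalPart (p (θ φ)) (θ φ)) - l) ^ 2 =
        l ^ 2 - boundaryArea p * A := fun φ hφ => by
    linear_combination boundaryArea p * hroot φ hφ
  have h0 := hsq u₀ ⟨le_rfl, hlt.le⟩
  have hφ' := hsq φ hφ
  by_cases hD : l ^ 2 - boundaryArea p * A = 0
  · rw [hD, sq_eq_zero_iff] at h0 hφ'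
    exact mul_left_cancel₀ hα.ne' (by linarith)
  -- With two distinct roots, `α (g/a) - l` has constant nonzero square, so its sign relative to the
  -- value at `u₀` is constant on the interval; the negative sign fails at `u₀` itself.
  · have key := isPreconnected_Icc.eq_or_eq_neg_of_sq_eq (S := Set.Icc u₀ u₁)
      (f := fun φ => boundaryArea p * (g φ / normalPart (p (θ φ)) (θ φ)) - l)
      (g := fun _ => boundaryArea p * (g u₀ / normalPart (p (θ u₀)) (θ u₀)) - l)
      ((hq.const_mul _).sub continuous_const).continuousOn continuousOn_const
      (fun x hx => by
        simp only [Pi.pow_apply]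
        rw [hsq x hx, h0])
      (fun {x} hx hz => hD (by rw [← h0, hz]; ring))
    rcases key with k | k
    · have := k hφ
      simp only at this
      exact mul_left_cancel₀ hα.ne' (by linarith)
    · have := k (show u₀ ∈ Set.Icc u₀ u₁ from ⟨le_rfl, hlt.le⟩)
      simp only [Pi.neg_apply] at this
      exact absurd (by rw [← h0, show boundaryArea p *
        (g u₀ / normalPart (p (θ u₀)) (θ u₀)) - l = 0 by linarith]; ring) hD

end IsSupportData

end MinkowskiPlane

end

/-! ### Area enclosed by a convex curve -/

section

open MeasureTheory

namespace MinkowskiPlane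

/-- The coordinates of the plane, as a pair. -/
noncomputable def coords : Plane ≃ᵐ ℝ × ℝ :=
  (MeasurableEquiv.toLp 2 (Fin 2 → ℝ)).symm.trans MeasurableEquiv.finTwoArrow

lemma measurePreserving_coords : MeasurePreserving coords volume volume :=
  (volume_preserving_finTwoArrow ℝ).comp (EuclideanSpace.volume_preserving_symm_measurableEquiv_toLp (Fin 2))

/-- The derivative of `(t, u) ↦ t γ u` in coordinates. -/
noncomputable def coneFDeriv (γ : ℝ → Plane) (x : ℝ × ℝ) : ℝ × ℝ →L[ℝ] ℝ × ℝ :=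
  (Matrix.toLin (Module.Basis.finTwoProd ℝ) (Module.Basis.finTwoProd ℝ)
    !![γ x.2 0, x.1 * deriv γ x.2 0; γ x.2 1, x.1 * deriv γ x.2 1]).toContinuousLinearMap

lemma hasFDerivAt_cone {γ : ℝ → Plane} (hγ : Differentiable ℝ γ) (x : ℝ × ℝ) :
    HasFDerivAt (fun x : ℝ × ℝ => (x.1 * γ x.2 0, x.1 * γ x.2 1)) (coneFDeriv γ x) x := by
  have hi : ∀ i, HasFDerivAt (fun x : ℝ × ℝ => x.1 * γ x.2 i)
      (x.1 • (deriv γ x.2 i • ContinuousLinearMap.snd ℝ ℝ ℝ) +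
        γ x.2 i • ContinuousLinearMap.fst ℝ ℝ ℝ) x := fun i =>
    (hasFDerivAt_fst (p := x)).mul
      ((hasDerivAt_coord (hγ x.2).hasDerivAt i).comp_hasFDerivAt x hasFDerivAt_snd)
  rw [coneFDeriv, Matrix.toLin_finTwoProd_toContinuousLinearMap]
  convert (hi 0).prodMk (hi 1) using 2 <;> ext <;> simp

lemma det_coneFDeriv (γ : ℝ → Plane) (x : ℝ × ℝ) :
    (coneFDeriv γ x).det = x.1 * det2 (γ x.2) (deriv γ x.2) := by
  rw [coneFDeriv, ContinuousLinearMap.det, LinearMap.coe_toContinuousLinearMap, LinearMap.det_toLin,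
    Matrix.det_fin_two_of, det2]
  ring

/-- A convex set with the origin in its interior is swept by the segments from the origin to the
boundary. -/
lemma image_cone {K : Set Plane} (hK : Convex ℝ K) (hc : IsCompact K) (h0 : (0 : Plane) ∈ interior K)
    {γ : ℝ → Plane} {T : ℝ} (hT : 0 < T) (hper : Function.Periodic γ T)
    (hrange : Set.range γ = frontier K) :
    (fun x : ℝ × ℝ => x.1 • γ x.2) '' (Set.Ioo 0 1 ×ˢ Set.Ico 0 T) = interior K \ {0} := by
  have hn : K ∈ nhds (0 : Plane) := mem_interior_iff_mem_nhds.1 h0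
  have hg1 : ∀ u, gauge K (γ u) = 1 := fun u =>
    (gauge_eq_one_iff_mem_frontier hK hn).2 (hrange ▸ Set.mem_range_self u)
  ext x
  constructor
  · rintro ⟨⟨t, u⟩, ⟨ht, -⟩, rfl⟩
    have hg : gauge K (t • γ u) = t := by
      rw [gauge_smul_of_nonneg ht.1.le, hg1, smul_eq_mul, mul_one]
    refine ⟨(gauge_lt_one_iff_mem_interior hK hn).1 (hg.trans_lt ht.2), fun hz => ?_⟩
    rw [Set.mem_singleton_iff] at hz
    simp only [hz, gauge_zero] at hg
    exact ht.1.ne hg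
  · rintro ⟨hx, hx0⟩
    have hpos : 0 < gauge K x :=
      (gauge_pos (absorbent_nhds_zero hn) (NormedSpace.isVonNBounded_iff ℝ |>.2 hc.isBounded)).2 hx0
    have hlt : gauge K x < 1 := (gauge_lt_one_iff_mem_interior hK hn).2 hx
    have hf : (gauge K x)⁻¹ • x ∈ Set.range γ := by
      rw [hrange, ← gauge_eq_one_iff_mem_frontier hK hn, gauge_smul_of_nonneg (inv_nonneg.2 hpos.le),
        smul_eq_mul, inv_mul_cancel₀ hpos.ne']
    obtain ⟨u, hu⟩ := hf
    obtain ⟨v, hv, hvu⟩ := hper.exists_mem_Ico₀ hT u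
    refine ⟨(gauge K x, v), ⟨⟨hpos, hlt⟩, hv⟩, ?_⟩
    simp only
    rw [← hvu, hu, smul_smul, mul_inv_cancel₀ hpos.ne', one_smul]

/-- The area bounded by a convex curve around the origin. -/
theorem area_eq_of_zero_mem {K : Set Plane} (hK : Convex ℝ K) (hc : IsCompact K)
    (h0 : (0 : Plane) ∈ interior K) {γ : ℝ → Plane} {T : ℝ} (hT : 0 < T)
    (hγ : Differentiable ℝ γ) (hper : Function.Periodic γ T)
    (hinj : Set.InjOn γ (Set.Ico 0 T)) (hrange : Set.range γ = frontier K) :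
    area K = (∫ u in (0 : ℝ)..T, |det2 (γ u) (deriv γ u)|) / 2 := by
  have hn : K ∈ nhds (0 : Plane) := mem_interior_iff_mem_nhds.1 h0
  have hg1 : ∀ u, gauge K (γ u) = 1 := fun u =>
    (gauge_eq_one_iff_mem_frontier hK hn).2 (hrange ▸ Set.mem_range_self u)
  set s : Set (ℝ × ℝ) := Set.Ioo 0 1 ×ˢ Set.Ico 0 T with hs
  have hsm : MeasurableSet s := measurableSet_Ioo.prod measurableSet_Ico
  -- The gauge of `t γ u` is `t`, which recovers the radial coordinate; simplicity of `γ` then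
  -- recovers `u`.
  have hinjΦ : Set.InjOn (fun x : ℝ × ℝ => (x.1 * γ x.2 0, x.1 * γ x.2 1)) s := by
    rintro ⟨t, u⟩ ⟨ht, hu⟩ ⟨t', u'⟩ ⟨ht', hu'⟩ heq
    simp only [Prod.mk.injEq] at heq
    have hv : t • γ u = t' • γ u' := plane_ext (by simpa using heq.1) (by simpa using heq.2)
    have hg := congrArg (gauge K) hv
    rw [gauge_smul_of_nonneg ht.1.le, gauge_smul_of_nonneg ht'.1.le, hg1, hg1, smul_eq_mul,
      smul_eq_mul, mul_one, mul_one] at hg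
    subst hg
    exact congrArg (Prod.mk t) (hinj hu hu' (smul_right_injective _ ht.1.ne' hv))
  -- Change of variables in generalized polar coordinates: the Jacobian is `t [γ, γ']`, and the
  -- integral of `t` over `(0, 1)` supplies the factor `1 / 2`.
  have himg := integral_image_eq_integral_abs_det_fderiv_smul volume hsm
    (fun x _ => (hasFDerivAt_cone hγ x).hasFDerivWithinAt) hinjΦ (fun _ => (1 : ℝ))
  simp only [det_coneFDeriv, smul_eq_mul, mul_one, abs_mul] at himg
  rw [Measure.volume_eq_prod, hs, setIntegral_prod_mul (fun t : ℝ => |t|)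
    (fun u => |det2 (γ u) (deriv γ u)|), ← Measure.volume_eq_prod] at himg
  have hset : (fun x : ℝ × ℝ => (x.1 * γ x.2 0, x.1 * γ x.2 1)) '' (Set.Ioo 0 1 ×ˢ Set.Ico 0 T) =
      coords '' (interior K \ {0}) := by
    rw [← image_cone hK hc h0 hT hper hrange, Set.image_image]
    rfl
  have hvol : volume (coords '' (interior K \ {0})) = volume K := by
    rw [coords.image_eq_preimage_symm,
      (measurePreserving_coords.symm coords).measure_preimage_equiv,
      measure_sdiff_null (measure_singleton 0)]
    exact measure_congr (interior_ae_eq_of_null_frontier (hK.addHaar_frontier volume))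
  have ht : ∫ t in Set.Ioo (0 : ℝ) 1, |t| = 1 / 2 := by
    rw [← integral_Ioc_eq_integral_Ioo, ← intervalIntegral.integral_of_le zero_le_one]
    rw [intervalIntegral.integral_congr (g := fun t => t) (fun t ht => by
      rw [Set.uIcc_of_le zero_le_one] at ht; exact abs_of_nonneg ht.1)]
    simp
  rw [hset, integral_const, smul_eq_mul, mul_one, measureReal_restrict_apply_univ, Measure.real,
    hvol, ht, integral_Ico_eq_integral_Ioo, ← integral_Ioc_eq_integral_Ioo,
    ← intervalIntegral.integral_of_le hT.le] at himg
  rw [area, himg]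
  ring

/-- The area bounded by a convex curve around the point `o`. -/
theorem area_eq {K : Set Plane} (hK : Convex ℝ K) (hc : IsCompact K) {o : Plane}
    (ho : o ∈ interior K) {γ : ℝ → Plane} {T : ℝ} (hT : 0 < T) (hγ : Differentiable ℝ γ)
    (hper : Function.Periodic γ T) (hinj : Set.InjOn γ (Set.Ico 0 T))
    (hrange : Set.range γ = frontier K) :
    area K = (∫ u in (0 : ℝ)..T, |det2 (γ u - o) (deriv γ u)|) / 2 := by
  set e := Homeomorph.addRight o with he
  have h := area_eq_of_zero_mem (K := e ⁻¹' K) (γ := fun u => γ u - o) (T := T)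
    (hK.translate_preimage_left o) (e.isCompact_preimage.2 hc)
    (by rw [← e.preimage_interior]; simpa [he] using ho) hT (hγ.sub_const o)
    (fun u => by simp only [hper u]) (fun u hu v hv huv => hinj hu hv (sub_left_injective huv))
    (by
      rw [← e.preimage_frontier, ← hrange]
      ext x
      simp only [Set.mem_range, he, Set.mem_preimage, Homeomorph.coe_addRight]
      exact exists_congr fun u => sub_eq_iff_eq_add)
  simp only [deriv_sub_const] at h
  rw [← h, area, area, he]
  congr 1
  exact (measure_preimage_add_right volume o K).symm

lemma IsUnitBall.area_eq {P : Set Plane} {p : ℝ → Plane} (hP : IsUnitBall P p) :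
    area P = (∫ t in (0 : ℝ)..2 * Real.pi, normalPart (p t) t * IsUnitBall.radius p t) / 2 := by
  rw [area_eq_of_zero_mem hP.strictConvex.convex hP.isCompact hP.zero_mem_interior Real.two_pi_pos
    (hP.smooth.differentiable (by simp)) hP.periodic hP.injOn hP.range_eq]
  simp only [hP.det2_deriv, abs_of_pos (mul_pos (hP.support_pos _) (hP.radius_pos _))]

end MinkowskiPlane

end

/-! ### Convex curves: tangent angle, orientation and bisecting chord -/

section

open MeasureTheory

namespace MinkowskiPlane

/-- A regular curve runs counterclockwise around its convex hull: the hull lies to the left of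
every tangent line, and touches it only at the point of tangency. -/
def IsCounterclockwise (γ : ℝ → Plane) : Prop :=
  ∀ u, ∀ x ∈ convexHull ℝ (Set.range γ), x ≠ γ u → det2 (x - γ u) (deriv γ u) < 0

lemma clm_apply_eq (f : Plane →L[ℝ] ℝ) (x : Plane) :
    f x = x 0 * f (EuclideanSpace.single 0 1) + x 1 * f (EuclideanSpace.single 1 1) := by
  have hx : x = x 0 • EuclideanSpace.single (0 : Fin 2) (1 : ℝ) +
      x 1 • EuclideanSpace.single (1 : Fin 2) (1 : ℝ) := by
    apply plane_ext <;> simp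
  conv_lhs => rw [hx]
  simp

lemma norm_sq_plane (x : Plane) : ‖x‖ ^ 2 = x 0 ^ 2 + x 1 ^ 2 := by
  simp [EuclideanSpace.real_norm_sq_eq]

lemma norm_eTheta (θ : ℝ) : ‖eTheta θ‖ = 1 := by
  refine (pow_eq_one_iff_of_nonneg (norm_nonneg _) two_ne_zero).1 ?_
  rw [norm_sq_plane, eTheta_zero, eTheta_one, neg_sq, Real.sin_sq_add_cos_sq]

lemma exists_eTheta_eq {v : Plane} (hv : v ≠ 0) :
    ∃ c : ℝ, 0 < c ∧ v = c • eTheta (Complex.arg ⟨v 0, v 1⟩ - Real.pi / 2) := by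
  set z : ℂ := ⟨v 0, v 1⟩ with hz
  have hz0 : z ≠ 0 := fun h => hv (plane_ext (congrArg Complex.re h) (congrArg Complex.im h))
  refine ⟨‖z‖, norm_pos_iff.2 hz0, plane_ext ?_ ?_⟩
  · simp [Real.sin_sub, hz]
  · simp [Real.cos_sub, hz]

/-- For the angle lift: a solution of `f' = l f` stays zero or keeps its sign according to its
initial value. -/
lemma eq_exp_integral {f l : ℝ → ℝ} (hl : Continuous l) (hf : ∀ u, HasDerivAt f (l u * f u) u)
    (u : ℝ) : f u = f 0 * Real.exp (∫ x in (0 : ℝ)..u, l x) := by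
  have hd : ∀ u, HasDerivAt (fun u => f u * Real.exp (-∫ x in (0 : ℝ)..u, l x)) 0 u := fun u => by
    refine ((hf u).mul (hl.integral_hasStrictDerivAt 0 u).hasDerivAt.fun_neg.exp).congr_deriv ?_
    ring
  have hconst := is_const_of_deriv_eq_zero (fun u => (hd u).differentiableAt)
    (fun u => (hd u).deriv) u 0
  simp only [intervalIntegral.integral_same, neg_zero, Real.exp_zero, mul_one] at hconst
  rw [← hconst, mul_assoc, ← Real.exp_add, neg_add_cancel, Real.exp_zero, mul_one]

/-- The tangent angle of a regular curve can be chosen continuously. -/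
theorem exists_angle_lift {γ : ℝ → Plane} (hγ : ContDiff ℝ ∞ γ) (hreg : ∀ u, deriv γ u ≠ 0) :
    ∃ θ σ : ℝ → ℝ, (∀ u, HasDerivAt θ (angularRate γ u) u) ∧ Continuous σ ∧
      Continuous (angularRate γ) ∧ ∀ u, 0 < σ u ∧ deriv γ u = σ u • eTheta (θ u) := by
  have hd1 : ContDiff ℝ ∞ (deriv γ) := (contDiff_infty_iff_deriv.1 hγ).2
  have hc1 : Continuous (deriv γ) := hd1.continuous
  have hc2 : Continuous (deriv (deriv γ)) := hd1.continuous_deriv (by simp)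
  have hd2 : ∀ u, HasDerivAt (deriv γ) (deriv (deriv γ) u) u := fun u =>
    (hd1.differentiable (by simp) u).hasDerivAt
  have hn : ∀ u, ‖deriv γ u‖ ^ 2 ≠ 0 := fun u => pow_ne_zero 2 (norm_ne_zero_iff.2 (hreg u))
  have hκ : Continuous (angularRate γ) :=
    (continuous_det2 hc1 hc2).div (by fun_prop) hn
  set l : ℝ → ℝ := fun u => (deriv γ u 0 * deriv (deriv γ) u 0 +
    deriv γ u 1 * deriv (deriv γ) u 1) / ‖deriv γ u‖ ^ 2 with hl
  have hlc : Continuous l := by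
    refine Continuous.div ?_ (by fun_prop) hn
    fun_prop
  obtain ⟨c, hc, hc0⟩ := exists_eTheta_eq (hreg 0)
  set θ₀ := Complex.arg ⟨deriv γ 0 0, deriv γ 0 1⟩ - Real.pi / 2
  set θ : ℝ → ℝ := fun u => θ₀ + ∫ x in (0 : ℝ)..u, angularRate γ x with hθ
  have hθd : ∀ u, HasDerivAt θ (angularRate γ u) u := fun u =>
    (hκ.integral_hasStrictDerivAt 0 u).hasDerivAt.const_add θ₀
  have hθ0 : θ 0 = θ₀ := by simp [hθ]
  -- In the frame turning at the rate of `γ'`, both components of `γ'` satisfy `f' = l f`, where `l`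
  -- is the logarithmic derivative of `|γ'|`. Hence the normal one remains `0` and the tangential
  -- one positive.
  have hN : ∀ u, HasDerivAt (fun u => normalPart (deriv γ u) (θ u))
      (l u * normalPart (deriv γ u) (θ u)) u := fun u => by
    refine (hasDerivAt_normalPart (hd2 u) (hθd u)).congr_deriv ?_
    have := hn u
    rw [norm_sq_plane] at this
    simp only [hl, angularRate, normalPart, tangentPart, det2, norm_sq_plane]
    field_simp
    ring
  have hT : ∀ u, HasDerivAt (fun u => tangentPart (deriv γ u) (θ u))
      (l u * tangentPart (deriv γ u) (θ u)) u := fun u => by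
    refine (hasDerivAt_tangentPart (hd2 u) (hθd u)).congr_deriv ?_
    have := hn u
    rw [norm_sq_plane] at this
    simp only [hl, angularRate, normalPart, tangentPart, det2, norm_sq_plane]
    field_simp
    ring
  have hT0 : tangentPart (deriv γ 0) (θ 0) = c := by
    rw [hθ0, hc0, tangentPart_smul, tangentPart_eTheta, mul_one]
  have hN0 : normalPart (deriv γ 0) (θ 0) = 0 := by
    rw [hθ0, hc0, normalPart_smul, normalPart_eTheta, mul_zero]
  have hθc : Continuous θ := continuous_iff_continuousAt.2 fun u => (hθd u).continuousAt
  refine ⟨θ, fun u => tangentPart (deriv γ u) (θ u), hθd, continuous_tangentPart hc1 hθc, hκ,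
    fun u => ⟨?_, ?_⟩⟩
  · refine lt_of_lt_of_eq (mul_pos hc (Real.exp_pos (∫ x in (0 : ℝ)..u, l x))) ?_
    rw [← hT0]
    exact (eq_exp_integral hlc hT u).symm
  · refine ext_of_parts (θ := θ u) ?_ ?_
    · rw [normalPart_smul, normalPart_eTheta, mul_zero, eq_exp_integral hlc hN u, hN0, zero_mul]
    · rw [tangentPart_smul, tangentPart_eTheta, mul_one]

namespace IsStrictlyConvexCurve

variable {γ : ℝ → Plane} {T : ℝ}

lemma hasDerivAt (hγ : IsStrictlyConvexCurve γ T) (u : ℝ) : HasDerivAt γ (deriv γ u) u :=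
  (hγ.smooth.differentiable (by simp) u).hasDerivAt

lemma contDiff_deriv (hγ : IsStrictlyConvexCurve γ T) : ContDiff ℝ ∞ (deriv γ) :=
  (contDiff_infty_iff_deriv.1 hγ.smooth).2

lemma continuous_deriv (hγ : IsStrictlyConvexCurve γ T) : Continuous (deriv γ) :=
  hγ.contDiff_deriv.continuous

lemma deriv_periodic (hγ : IsStrictlyConvexCurve γ T) : Function.Periodic (deriv γ) T := fun u => by
  rw [← deriv_comp_add_const]
  congr 1
  exact funext hγ.closed

lemma isCompact (hγ : IsStrictlyConvexCurve γ T) : IsCompact (convexHull ℝ (Set.range γ)) := by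
  have hr : IsCompact (Set.range γ) := by
    rw [← hγ.closed.image_Icc hγ.period_pos 0]
    exact isCompact_Icc.image hγ.smooth.continuous
  refine Metric.isCompact_of_isClosed_isBounded ?_ (isBounded_convexHull.2 hr.isBounded)
  rw [← frontier_subset_iff_isClosed, ← hγ.range_eq]
  exact subset_convexHull ℝ _

lemma ne_of_lt_period (hγ : IsStrictlyConvexCurve γ T) {u v : ℝ} (huv : u < v) (hvu : v < u + T) :
    γ u ≠ γ v := by
  intro heq
  obtain ⟨n, hn, -⟩ := existsUnique_sub_zsmul_mem_Ico hγ.period_pos u 0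
  rw [zero_add] at hn
  have h1 : γ (u - n • T) = γ u := hγ.closed.sub_zsmul_eq n
  have h2 : γ (v - n • T) = γ v := hγ.closed.sub_zsmul_eq n
  rcases lt_or_ge (v - n • T) T with h | h
  · have := hγ.simple hn ⟨by linarith [hn.1], h⟩ (h1.trans (heq.trans h2.symm))
    linarith
  · have h3 : γ (v - n • T - T) = γ v := by rw [hγ.closed.sub_eq, h2]
    have := hγ.simple hn ⟨by linarith, by linarith [hn.2]⟩ (h1.trans (heq.trans h3.symm))
    linarith

lemma mem_hull (u : ℝ) : γ u ∈ convexHull ℝ (Set.range γ) :=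
  subset_convexHull ℝ _ (Set.mem_range_self u)

lemma nonempty_interior (hγ : IsStrictlyConvexCurve γ T) :
    (interior (convexHull ℝ (Set.range γ))).Nonempty := by
  have hT := hγ.period_pos
  have hne : γ 0 ≠ γ (T / 2) := hγ.ne_of_lt_period (by linarith) (by linarith)
  exact ⟨_, hγ.strictConvex (mem_hull 0) (mem_hull (T / 2)) hne (a := 1 / 2) (b := 1 / 2)
    (by norm_num) (by norm_num) (by norm_num)⟩

/-- The tangent line is a supporting line. -/
lemma exists_supporting (hγ : IsStrictlyConvexCurve γ T) (u : ℝ) :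
    ∃ c : ℝ, ∀ x ∈ convexHull ℝ (Set.range γ), x ≠ γ u → c * det2 (x - γ u) (deriv γ u) < 0 := by
  set K := convexHull ℝ (Set.range γ) with hK
  have hu : γ u ∉ interior K := by
    have : γ u ∈ frontier K := by rw [← hγ.range_eq]; exact Set.mem_range_self u
    exact this.2
  obtain ⟨f, hf⟩ := geometric_hahn_banach_open_point (convex_convexHull ℝ (Set.range γ)).interior
    isOpen_interior hu
  have hlt : ∀ x ∈ K, x ≠ γ u → f x < f (γ u) := by
    intro x hx hne
    have := hf _ (hγ.strictConvex hx (mem_hull u) hne (a := 1 / 2) (b := 1 / 2)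
      (by norm_num) (by norm_num) (by norm_num))
    simp only [map_add, map_smul, smul_eq_mul] at this
    linarith
  have hmax : IsLocalMax (fun v => f (γ v)) u := Filter.Eventually.of_forall fun v => by
    by_cases h : γ v = γ u
    · simp only [h, le_refl]
    · exact (hlt _ (mem_hull v) h).le
  have h0 : f (deriv γ u) = 0 :=
    hmax.hasDerivAt_eq_zero (f.hasFDerivAt.comp_hasDerivAt u (hγ.hasDerivAt u))
  have hn : 0 < ‖deriv γ u‖ ^ 2 := pow_pos (norm_pos_iff.2 (hγ.regular u)) 2
  set f₀ := f (EuclideanSpace.single 0 1)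
  set f₁ := f (EuclideanSpace.single 1 1)
  -- A functional that kills `γ' u` is a multiple of `[·, γ' u]`; this is the factor.
  refine ⟨(f₀ * deriv γ u 1 - f₁ * deriv γ u 0) / ‖deriv γ u‖ ^ 2, fun x hx hne => ?_⟩
  have h1 : f (x - γ u) < 0 := by rw [map_sub]; linarith [hlt x hx hne]
  rw [clm_apply_eq] at h0 h1
  rw [div_mul_eq_mul_div, div_lt_iff₀ hn, zero_mul]
  have h2 : (f₀ * deriv γ u 1 - f₁ * deriv γ u 0) * det2 (x - γ u) (deriv γ u) =
      ((x - γ u) 0 * f₀ + (x - γ u) 1 * f₁) * ‖deriv γ u‖ ^ 2 := by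
    rw [norm_sq_plane, det2]
    linear_combination (-(x - γ u) 0 * deriv γ u 0 - (x - γ u) 1 * deriv γ u 1) * h0
  rw [h2]
  exact mul_neg_of_neg_of_pos h1 hn

lemma reverse (hγ : IsStrictlyConvexCurve γ T) : IsStrictlyConvexCurve (fun u => γ (-u)) T := by
  have hr : Set.range (fun u => γ (-u)) = Set.range γ := (Equiv.neg ℝ).surjective.range_comp γ
  refine ⟨hγ.period_pos, hγ.smooth.comp contDiff_neg, fun u => ?_, fun u => ?_, ?_, ?_, ?_⟩
  · rw [deriv_comp_neg]; exact neg_ne_zero.2 (hγ.regular _)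
  · simp only [neg_add, ← sub_eq_add_neg, hγ.closed.sub_eq]
  · have key : ∀ u v, 0 ≤ u → u < v → v < T → γ (-u) ≠ γ (-v) := fun u v hu huv hv =>
      (hγ.ne_of_lt_period (by linarith) (by linarith)).symm
    intro u hu v hv heq
    by_contra hne
    rcases lt_or_gt_of_ne hne with h | h
    · exact key u v hu.1 h hv.2 heq
    · exact key v u hv.1 h hu.2 heq.symm
  · rw [hr]; exact hγ.strictConvex
  · rw [hr]; exact hγ.range_eq

/-- For an interior point `o`, the supporting tangents keep `[o - γ, γ']` away from zero, so its
sign is constant. That sign fixes the side on which the hull lies at every tangent. -/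
lemma isCounterclockwise_or (hγ : IsStrictlyConvexCurve γ T) :
    IsCounterclockwise γ ∨ IsCounterclockwise fun u => γ (-u) := by
  obtain ⟨o, ho⟩ := hγ.nonempty_interior
  have hoK := interior_subset ho
  have hou : ∀ u, o ≠ γ u := fun u h => by
    have : γ u ∈ frontier (convexHull ℝ (Set.range γ)) := by
      rw [← hγ.range_eq]; exact Set.mem_range_self u
    exact this.2 (h ▸ ho)
  have hc : Continuous fun u => det2 (o - γ u) (deriv γ u) :=
    continuous_det2 (continuous_const.sub hγ.smooth.continuous) hγ.continuous_deriv
  have hne : ∀ u, det2 (o - γ u) (deriv γ u) ≠ 0 := fun u h => by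
    obtain ⟨c, hc⟩ := hγ.exists_supporting u
    have := hc o hoK (hou u)
    rw [h, mul_zero] at this
    exact lt_irrefl _ this
  by_cases h : ∀ u, det2 (o - γ u) (deriv γ u) < 0
  · left
    intro u x hx hxu
    obtain ⟨c, hc⟩ := hγ.exists_supporting u
    have h1 := hc o hoK (hou u)
    have h2 := hc x hx hxu
    have hcpos : 0 < c := by
      by_contra hcn
      nlinarith [h u, mul_nonneg_of_nonpos_of_nonpos (not_lt.1 hcn) (h u).le]
    exact (pos_iff_neg_of_mul_neg h2).1 hcpos
  · right
    push Not at h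
    obtain ⟨v, hv⟩ := h
    have hpos : ∀ u, 0 < det2 (o - γ u) (deriv γ u) := fun u => by
      by_contra hu
      obtain ⟨w, hw⟩ := mem_range_of_exists_le_of_exists_ge hc ⟨u, not_lt.1 hu⟩ ⟨v, hv⟩
      exact hne w hw
    have hr : Set.range (fun u => γ (-u)) = Set.range γ := (Equiv.neg ℝ).surjective.range_comp γ
    intro u x hx hxu
    rw [hr] at hx
    obtain ⟨c, hc⟩ := hγ.exists_supporting (-u)
    have h1 := hc o hoK (hou (-u))
    have h2 := hc x hx hxu
    have hcneg : c < 0 := by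
      by_contra hcn
      nlinarith [hpos (-u), mul_nonneg (not_lt.1 hcn) (hpos (-u)).le]
    have h3 : 0 < det2 (x - γ (-u)) (deriv γ (-u)) := (neg_iff_pos_of_mul_neg h2).1 hcneg
    rw [deriv_comp_neg, ← neg_one_smul ℝ, det2_smul_right]
    linarith

/-- The function `[γ v - γ u, γ' u]` of `v` is maximal at `u`. A negative rate would make its second
derivative positive there, so `u` would be a local minimum, although nearby values are strictly
smaller. -/
lemma angularRate_nonneg (hγ : IsStrictlyConvexCurve γ T) (hccw : IsCounterclockwise γ) (u : ℝ) :
    0 ≤ angularRate γ u := by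
  refine div_nonneg ?_ (sq_nonneg _)
  have hcomp : ∀ (f : ℝ → Plane) (f' w : Plane) (v : ℝ), HasDerivAt f f' v →
      HasDerivAt (fun v => det2 (f v) w) (det2 f' w) v := fun f f' w v hf =>
    ((hasDerivAt_coord hf 0).mul_const _).sub ((hasDerivAt_coord hf 1).mul_const _)
  have hd : deriv (fun v => det2 (γ v - γ u) (deriv γ u)) =
      fun v => det2 (deriv γ v) (deriv γ u) := funext fun v =>
    (hcomp _ _ _ v ((hγ.hasDerivAt v).sub_const (γ u))).deriv
  have hd2 : deriv (deriv fun v => det2 (γ v - γ u) (deriv γ u)) u =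
      det2 (deriv (deriv γ) u) (deriv γ u) := by
    rw [hd]
    exact (hcomp _ _ _ u (hγ.contDiff_deriv.differentiable (by simp) u).hasDerivAt).deriv
  by_contra hneg
  have hpos : 0 < deriv (deriv fun v => det2 (γ v - γ u) (deriv γ u)) u := by
    rw [hd2]
    simp only [det2] at hneg ⊢
    linarith
  have hmin := isLocalMin_of_deriv_deriv_pos hpos (by rw [hd]; simp only [det2]; ring)
    (hcomp _ _ _ u ((hγ.hasDerivAt u).sub_const (γ u))).continuousAt
  have hev : ∀ᶠ v in nhds u, u < v → v < u + T → False := by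
    filter_upwards [hmin] with v hv h1 h2
    have := hccw u (γ v) (mem_hull v) (hγ.ne_of_lt_period h1 h2).symm
    simp only [sub_self] at hv
    have h0 : det2 0 (deriv γ u) = 0 := by simp [det2]
    linarith
  obtain ⟨ε, hε, hball⟩ := Metric.eventually_nhds_iff.1 hev
  have hT := hγ.period_pos
  have hm : 0 < min ε T := lt_min hε hT
  refine hball (y := u + min ε T / 2) ?_ (by linarith) (by linarith [min_le_right ε T])
  rw [Real.dist_eq, add_sub_cancel_left, abs_of_pos (by linarith)]
  linarith [min_le_left ε T]

end IsStrictlyConvexCurve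

/-- A strictly convex curve, run through counterclockwise, with its tangent angle `θ` and its
Euclidean speed `σ`. -/
structure IsOrientedCurve (γ : ℝ → Plane) (T : ℝ) (θ σ : ℝ → ℝ) : Prop where
  curve : IsStrictlyConvexCurve γ T
  ccw : IsCounterclockwise γ
  hasDerivAt_angle : ∀ u, HasDerivAt θ (angularRate γ u) u
  continuous_rate : Continuous (angularRate γ)
  continuous_speed : Continuous σ
  speed_pos : ∀ u, 0 < σ u
  deriv_eq : ∀ u, deriv γ u = σ u • eTheta (θ u)

lemma IsStrictlyConvexCurve.exists_oriented {γ : ℝ → Plane} {T : ℝ}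
    (hγ : IsStrictlyConvexCurve γ T) (hccw : IsCounterclockwise γ) :
    ∃ θ σ, IsOrientedCurve γ T θ σ := by
  obtain ⟨θ, σ, h1, h2, h3, h4⟩ := exists_angle_lift hγ.smooth hγ.regular
  exact ⟨θ, σ, hγ, hccw, h1, h3, h2, fun u => (h4 u).1, fun u => (h4 u).2⟩

namespace IsOrientedCurve

variable {γ : ℝ → Plane} {T : ℝ} {θ σ : ℝ → ℝ}

lemma continuous_angle (h : IsOrientedCurve γ T θ σ) : Continuous θ :=
  continuous_iff_continuousAt.2 fun u => (h.hasDerivAt_angle u).continuousAt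

lemma continuous_curve (h : IsOrientedCurve γ T θ σ) : Continuous γ := h.curve.smooth.continuous

lemma normalPart_lt (h : IsOrientedCurve γ T θ σ) {u : ℝ} {x : Plane}
    (hx : x ∈ convexHull ℝ (Set.range γ)) (hne : x ≠ γ u) :
    normalPart x (θ u) < normalPart (γ u) (θ u) := by
  have := h.ccw u x hx hne
  rw [h.deriv_eq, det2_smul_right, det2_eTheta, normalPart_sub] at this
  have := (pos_iff_neg_of_mul_neg this).1 (h.speed_pos u)
  linarith

/-- Parallel tangents of the same direction only occur at one point. -/
lemma eTheta_ne (h : IsOrientedCurve γ T θ σ) {u v : ℝ} (huv : u < v) (hvu : v < u + T) :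
    eTheta (θ u) ≠ eTheta (θ v) := by
  intro heq
  have hne := h.curve.ne_of_lt_period huv hvu
  have h1 := h.normalPart_lt (IsStrictlyConvexCurve.mem_hull v) hne.symm
  have h2 := h.normalPart_lt (IsStrictlyConvexCurve.mem_hull u) hne
  rw [← det2_eTheta, ← det2_eTheta] at h1 h2
  rw [heq] at h1
  linarith

/-- The turning rate may vanish, so strictness comes from `eTheta_ne` instead; the minimum with `u +
T / 2` keeps the comparison within one period. -/
lemma strictMono (h : IsOrientedCurve γ T θ σ) : StrictMono θ := by
  have hm : Monotone θ := monotone_of_deriv_nonneg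
    (fun u => (h.hasDerivAt_angle u).differentiableAt)
    (fun u => by rw [(h.hasDerivAt_angle u).deriv]; exact h.curve.angularRate_nonneg h.ccw u)
  intro u v huv
  have hT := h.curve.period_pos
  have h1 : u < min v (u + T / 2) := lt_min huv (by linarith)
  have h2 := h.eTheta_ne h1 (by linarith [min_le_right v (u + T / 2)])
  exact (lt_of_le_of_ne (hm h1.le) fun heq => h2 (by rw [heq])).trans_le (hm (min_le_left _ _))

lemma angularRate_periodic (h : IsOrientedCurve γ T θ σ) :
    Function.Periodic (angularRate γ) T := fun u => by
  have h1 := h.curve.deriv_periodic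
  have h2 : deriv (deriv γ) (u + T) = deriv (deriv γ) u := by
    rw [← deriv_comp_add_const]
    congr 1
    exact funext h1
  rw [angularRate, angularRate, h1, h2]

lemma speed_eq (h : IsOrientedCurve γ T θ σ) (u : ℝ) : σ u = tangentPart (deriv γ u) (θ u) := by
  rw [h.deriv_eq, tangentPart_smul, tangentPart_eTheta, mul_one]

lemma norm_deriv (h : IsOrientedCurve γ T θ σ) (u : ℝ) : ‖deriv γ u‖ = σ u := by
  rw [h.deriv_eq, norm_smul, norm_eTheta, Real.norm_of_nonneg (h.speed_pos u).le, mul_one]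

lemma speed_periodic (h : IsOrientedCurve γ T θ σ) : Function.Periodic σ T := fun u => by
  rw [← h.norm_deriv, ← h.norm_deriv, h.curve.deriv_periodic]

/-- The total turning is a positive multiple of `2π`. If it exceeded `2π`, a tangent direction would
recur strictly within a period. -/
lemma angle_add_period (h : IsOrientedCurve γ T θ σ) (u : ℝ) :
    θ (u + T) = θ u + 2 * Real.pi := by
  have hT := h.curve.period_pos
  have heq : eTheta (θ (u + T)) = eTheta (θ u) := by
    have := h.curve.deriv_periodic u
    rw [h.deriv_eq, h.deriv_eq, h.speed_periodic] at this
    exact smul_right_injective _ (h.speed_pos u).ne' this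
  obtain ⟨n, hn⟩ := eTheta_eq_iff heq
  have hlt := h.strictMono (show u < u + T by linarith)
  have hn1 : 1 ≤ n := by
    by_contra hn0
    have : (n : ℝ) ≤ 0 := by exact_mod_cast (by lia : n ≤ 0)
    nlinarith [Real.two_pi_pos]
  rcases hn1.eq_or_lt with h1 | h1
  · rw [hn, ← h1]; simp
  · exfalso
    have h2 : (2 : ℝ) ≤ n := by exact_mod_cast (by lia : 2 ≤ n)
    have hp := Real.two_pi_pos
    obtain ⟨v, hv, hvθ⟩ := intermediate_value_Ioo (show u ≤ u + T by linarith)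
      h.continuous_angle.continuousOn
      (show θ u + 2 * Real.pi ∈ Set.Ioo (θ u) (θ (u + T)) from ⟨by linarith, by nlinarith⟩)
    exact h.eTheta_ne hv.1 hv.2 (by rw [hvθ, eTheta_add_two_pi])

lemma angle_surjective (h : IsOrientedCurve γ T θ σ) : Function.Surjective θ := by
  have hn : ∀ n : ℕ, θ (n • T) = θ 0 + n * (2 * Real.pi) ∧ θ (-(n • T)) = θ 0 - n * (2 * Real.pi) := by
    intro n
    induction n with
    | zero => simp
    | succ n ih =>
      have h1 := h.angle_add_period (n • T)
      have h2 := h.angle_add_period (-((n + 1) • T))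
      rw [show -((n + 1) • T) + T = -(n • T) by rw [succ_nsmul]; ring] at h2
      rw [succ_nsmul, h1, ih.1, ← succ_nsmul]
      push_cast
      exact ⟨by ring, by linarith [ih.2]⟩
  intro y
  obtain ⟨n, hy⟩ := exists_nat_ge (|y - θ 0| / (2 * Real.pi))
  rw [div_le_iff₀ Real.two_pi_pos] at hy
  have := abs_le.1 hy
  exact mem_range_of_exists_le_of_exists_ge h.continuous_angle
    ⟨_, (hn n).2.le.trans (by linarith)⟩ ⟨_, le_trans (by linarith) (hn n).1.ge⟩

lemma det2_pos (h : IsOrientedCurve γ T θ σ) {o : Plane}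
    (ho : o ∈ interior (convexHull ℝ (Set.range γ))) (u : ℝ) :
    0 < det2 (γ u - o) (deriv γ u) := by
  have hou : o ≠ γ u := fun he => by
    have : γ u ∈ frontier (convexHull ℝ (Set.range γ)) := by
      rw [← h.curve.range_eq]; exact Set.mem_range_self u
    exact this.2 (he ▸ ho)
  have := h.ccw u o (interior_subset ho) hou
  rw [det2_sub_left] at this ⊢
  linarith

lemma integral_det2_const (h : IsOrientedCurve γ T θ σ) (o : Plane) (x y : ℝ) :
    ∫ u in x..y, det2 o (deriv γ u) = det2 o (γ y) - det2 o (γ x) := by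
  refine intervalIntegral.integral_eq_sub_of_hasDerivAt (f := fun u => det2 o (γ u)) (fun u _ => ?_)
    ((continuous_det2 continuous_const h.curve.continuous_deriv).intervalIntegrable _ _)
  exact ((hasDerivAt_coord (h.curve.hasDerivAt u) 1).const_mul _).sub
    ((hasDerivAt_coord (h.curve.hasDerivAt u) 0).const_mul _)

lemma integral_det2_sub (h : IsOrientedCurve γ T θ σ) (o : Plane) (x y : ℝ) :
    ∫ u in x..y, det2 (γ u - o) (deriv γ u) =
      (∫ u in x..y, det2 (γ u) (deriv γ u)) - (det2 o (γ y) - det2 o (γ x)) := by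
  simp only [det2_sub_left]
  rw [intervalIntegral.integral_sub, h.integral_det2_const]
  · exact (continuous_det2 h.continuous_curve h.curve.continuous_deriv).intervalIntegrable _ _
  · exact (continuous_det2 continuous_const h.curve.continuous_deriv).intervalIntegrable _ _

/-- The area formula and positivity hold about an interior point `o`; the shift by `o` drops out
because `[o, γ']` integrates to zero over a closed curve. -/
lemma enclosedArea_eq (h : IsOrientedCurve γ T θ σ) :
    enclosedArea γ = (∫ u in (0 : ℝ)..T, det2 (γ u) (deriv γ u)) / 2 ∧ 0 < enclosedArea γ := by
  obtain ⟨o, ho⟩ := h.curve.nonempty_interior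
  have hA : enclosedArea γ = (∫ u in (0 : ℝ)..T, det2 (γ u - o) (deriv γ u)) / 2 := by
    rw [enclosedArea, area_eq (convex_convexHull ℝ _) h.curve.isCompact ho h.curve.period_pos
      (h.curve.smooth.differentiable (by simp)) h.curve.closed h.curve.simple h.curve.range_eq]
    simp only [abs_of_pos (h.det2_pos ho _)]
  refine ⟨?_, ?_⟩
  · rw [hA, h.integral_det2_sub, h.curve.closed.eq, sub_self, sub_zero]
  · rw [hA]
    refine half_pos (intervalIntegral.intervalIntegral_pos_of_pos_on ?_
      (fun u _ => h.det2_pos ho u) h.curve.period_pos)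
    exact (continuous_det2 (h.continuous_curve.sub continuous_const)
      h.curve.continuous_deriv).intervalIntegrable _ _

/-- Some chord with parallel tangents at its ends bisects the enclosed area. -/
theorem exists_bisecting_chord (h : IsOrientedCurve γ T θ σ) :
    ∃ (c : Plane) (u₀ u₁ : ℝ), θ u₁ = θ u₀ + Real.pi ∧ γ u₁ - c = -(γ u₀ - c) ∧
      (∫ u in u₀..u₁, det2 (γ u - c) (deriv γ u)) = enclosedArea γ ∧
      (∫ u in u₁..u₀ + T, det2 (γ u - c) (deriv γ u)) = enclosedArea γ := by
  set e : ℝ ≃o ℝ := h.strictMono.orderIsoOfSurjective θ h.angle_surjective with he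
  have hes : ∀ x, θ (e.symm x) = x := fun x => e.apply_symm_apply x
  -- `γ (τ u)` is the point with the opposite tangent direction; applying `τ` twice advances one
  -- period.
  set τ : ℝ → ℝ := fun u => e.symm (θ u + Real.pi) with hτ
  have hθτ : ∀ u, θ (τ u) = θ u + Real.pi := fun u => hes _
  have hinj := h.strictMono.injective
  have hττ : ∀ u, τ (τ u) = u + T := fun u => hinj (by
    rw [hθτ, hθτ, h.angle_add_period]; ring)
  have hτT : ∀ u, τ (u + T) = τ u + T := fun u => hinj (by
    rw [hθτ, h.angle_add_period, h.angle_add_period, hθτ]; ring)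
  have hτc : Continuous τ := e.symm.continuous.comp (h.continuous_angle.add continuous_const)
  have hdc : Continuous fun u => det2 (γ u) (deriv γ u) :=
    continuous_det2 h.continuous_curve h.curve.continuous_deriv
  have hdi : ∀ x y, IntervalIntegrable (fun u => det2 (γ u) (deriv γ u)) volume x y := fun x y =>
    hdc.intervalIntegrable x y
  have hper : Function.Periodic (fun u => det2 (γ u) (deriv γ u)) T := fun u => by
    simp only [h.curve.closed u, h.curve.deriv_periodic u]
  set I : ℝ → ℝ := fun x => ∫ u in (0 : ℝ)..x, det2 (γ u) (deriv γ u) with hI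
  have hIc : Continuous I := intervalIntegral.continuous_primitive hdi 0
  have hIsub : ∀ x y, ∫ u in x..y, det2 (γ u) (deriv γ u) = I y - I x := fun x y =>
    (intervalIntegral.integral_interval_sub_left (hdi 0 y) (hdi 0 x)).symm
  have hIT : ∀ x, I (x + T) = I x + I T := fun x => by
    have := hper.intervalIntegral_add_eq x 0
    rw [hIsub, zero_add] at this
    linarith
  have hA : I T = 2 * enclosedArea γ := by rw [h.enclosedArea_eq.1]; ring
  -- Twice the area between the arc from `u` to `τ u` and its chord. Since `S u + S (τ u) = 2 A` and
  -- `S - S ∘ τ` changes sign under `τ`, some chord has equal areas on its two sides.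
  set S : ℝ → ℝ := fun u => I (τ u) - I u - det2 (γ u) (γ (τ u)) with hS
  have hST : ∀ u, S (u + T) = S u := fun u => by
    simp only [hS, hτT, hIT, h.curve.closed _]; ring
  have hSc : Continuous S := ((hIc.comp hτc).sub hIc).sub
    (continuous_det2 h.continuous_curve (h.continuous_curve.comp hτc))
  have hDτ : ∀ u, S (τ u) - S (τ (τ u)) = -(S u - S (τ u)) := fun u => by rw [hττ, hST]; ring
  obtain ⟨u, hu⟩ : ∃ u, S u - S (τ u) = 0 := by
    have hDc : Continuous fun u => S u - S (τ u) := hSc.sub (hSc.comp hτc)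
    rcases le_total (S 0 - S (τ 0)) 0 with h0 | h0
    · exact mem_range_of_exists_le_of_exists_ge hDc ⟨0, h0⟩ ⟨τ 0, by rw [hDτ]; linarith⟩
    · exact mem_range_of_exists_le_of_exists_ge hDc ⟨τ 0, by rw [hDτ]; linarith⟩ ⟨0, h0⟩
  have hsum : S u + S (τ u) = 2 * enclosedArea γ := by
    simp only [hS, hττ, hIT, h.curve.closed _, hA, det2]
    ring
  -- About the midpoint, the chord contributes nothing to `∫ [γ - c, γ']`, so each arc integral is
  -- the corresponding value of `S`.
  refine ⟨(1 / 2 : ℝ) • (γ u + γ (τ u)), u, τ u, hθτ u, ?_, ?_, ?_⟩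
  · module
  · rw [h.integral_det2_sub, hIsub]
    have : S u = enclosedArea γ := by linarith
    rw [← this]
    simp [hS, det2]
    ring
  · rw [h.integral_det2_sub, hIsub]
    have : S (τ u) = enclosedArea γ := by linarith
    rw [← this]
    simp only [hS, hττ, h.curve.closed _]
    simp [det2]
    ring

end IsOrientedCurve
end MinkowskiPlane

end

/-! ### The inequality and its equality case for counterclockwise curves -/

section

open intervalIntegral

namespace MinkowskiPlane

lemma eTheta_eq_of_smul_eq {c d s t : ℝ} (hc : 0 < c) (hd : 0 < d)
    (h : c • eTheta s = d • eTheta t) : eTheta s = eTheta t := by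
  have hn := congrArg norm h
  rw [norm_smul, norm_smul, norm_eTheta, norm_eTheta, Real.norm_of_nonneg hc.le,
    Real.norm_of_nonneg hd.le, mul_one, mul_one] at hn
  subst hn
  exact smul_right_injective _ hc.ne' h

/-- Lets the principal-value parameter in `curvature` be replaced by the continuous tangent angle.
-/
lemma IsUnitBall.det2_deriv_congr {P : Set Plane} {p : ℝ → Plane} (hP : IsUnitBall P p) {s t : ℝ}
    (h : eTheta s = eTheta t) : det2 (p s) (deriv p s) = det2 (p t) (deriv p t) := by
  obtain ⟨n, rfl⟩ := eTheta_eq_iff h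
  have hper : Function.Periodic (fun t => normalPart (p t) t * radius p t) (2 * Real.pi) := by
    have hpi : Function.Periodic (fun t => normalPart (p t) t * radius p t) Real.pi := fun t => by
      simp only [hP.support_add_pi, hP.radius_add_pi]
    exact_mod_cast hpi.nat_mul 2
  rw [hP.det2_deriv, hP.det2_deriv]
  exact hper.int_mul n t

namespace IsOrientedCurve

variable {P : Set Plane} {p γ : ℝ → Plane} {T : ℝ} {θ σ : ℝ → ℝ}

lemma isSupportData (h : IsOrientedCurve γ T θ σ) (c : Plane) :
    IsSupportData θ (angularRate γ) σ (fun u => normalPart (γ u - c) (θ u))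
      (fun u => tangentPart (γ u - c) (θ u)) where
  hasDerivAt_angle := h.hasDerivAt_angle
  hasDerivAt_support u := by
    refine (hasDerivAt_normalPart ((h.curve.hasDerivAt u).sub_const c)
      (h.hasDerivAt_angle u)).congr_deriv ?_
    rw [h.deriv_eq, normalPart_smul, normalPart_eTheta, mul_zero, zero_add]
  hasDerivAt_tangent u := by
    refine (hasDerivAt_tangentPart ((h.curve.hasDerivAt u).sub_const c)
      (h.hasDerivAt_angle u)).congr_deriv ?_
    rw [← h.speed_eq]
  continuous_rate := h.continuous_rate
  continuous_speed := h.continuous_speed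
  rate_nonneg := h.curve.angularRate_nonneg h.ccw
  speed_pos := h.speed_pos
  strictMono := h.strictMono

lemma det2_eq (h : IsOrientedCurve γ T θ σ) (c : Plane) (u : ℝ) :
    det2 (γ u - c) (deriv γ u) = normalPart (γ u - c) (θ u) * σ u := by
  rw [h.deriv_eq, det2_smul_right, det2_eTheta, mul_comm]

lemma speedQ_eq (hP : IsUnitBall P p) (h : IsOrientedCurve γ T θ σ) (u : ℝ) :
    speedQ P γ u = normalPart (p (θ u)) (θ u) * σ u := by
  rw [speedQ, h.deriv_eq, hP.gauge_dualBall (h.speed_pos u), mul_comm]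

lemma curvature_eq (hP : IsUnitBall P p) (h : IsOrientedCurve γ T θ σ) (u : ℝ) :
    curvature P p γ u = IsUnitBall.radius p (θ u) * angularRate γ u / σ u := by
  obtain ⟨c, hc, heq⟩ := exists_eTheta_eq (h.curve.regular u)
  rw [h.deriv_eq] at heq
  have he : eTheta (tangentParam γ u) = eTheta (θ u) := by
    rw [tangentParam, h.deriv_eq]
    exact (eTheta_eq_of_smul_eq (h.speed_pos u) hc heq).symm
  rw [curvature, hP.det2_deriv_congr he, hP.det2_deriv, h.speedQ_eq hP]
  have h1 := (hP.support_pos (θ u)).ne'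
  have h2 := (h.speed_pos u).ne'
  field_simp

lemma support_periodic (hP : IsUnitBall P p) (h : IsOrientedCurve γ T θ σ) :
    Function.Periodic (fun u => normalPart (p (θ u)) (θ u)) T := fun u => by
  simp only [h.angle_add_period, two_mul, ← add_assoc, hP.support_add_pi]

lemma radius_periodic (hP : IsUnitBall P p) (h : IsOrientedCurve γ T θ σ) :
    Function.Periodic (fun u => IsUnitBall.radius p (θ u)) T := fun u => by
  simp only [h.angle_add_period, two_mul, ← add_assoc, hP.radius_add_pi]

lemma lengthQ_eq (hP : IsUnitBall P p) (h : IsOrientedCurve γ T θ σ) (u₀ : ℝ) :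
    lengthQ P γ T = ∫ u in u₀..u₀ + T, normalPart (p (θ u)) (θ u) * σ u := by
  have hper : Function.Periodic (fun u => normalPart (p (θ u)) (θ u) * σ u) T :=
    (h.support_periodic hP).mul h.speed_periodic
  rw [hper.intervalIntegral_add_eq u₀ 0, zero_add, lengthQ]
  simp only [h.speedQ_eq hP]

lemma curvatureSqIntegral_eq (hP : IsUnitBall P p) (h : IsOrientedCurve γ T θ σ) (u₀ : ℝ) :
    curvatureSqIntegral P p γ T = ∫ u in u₀..u₀ + T,
      (IsUnitBall.radius p (θ u) * angularRate γ u / σ u) ^ 2 *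
        (normalPart (p (θ u)) (θ u) * σ u) := by
  have hper : Function.Periodic (fun u =>
      (IsUnitBall.radius p (θ u) * angularRate γ u / σ u) ^ 2 *
        (normalPart (p (θ u)) (θ u) * σ u)) T := fun u => by
    have h1 := h.support_periodic hP u
    have h2 := h.radius_periodic hP u
    simp only at h1 h2
    simp only [h1, h2, h.angularRate_periodic u, h.speed_periodic u]
  rw [hper.intervalIntegral_add_eq u₀ 0, zero_add, curvatureSqIntegral]
  simp only [h.speedQ_eq hP, h.curvature_eq hP]

/-- The curve is determined by its support function. -/
lemma eq_of_support_eq (hP : IsUnitBall P p) (h : IsOrientedCurve γ T θ σ) {c : Plane} {r : ℝ}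
    (hr : ∀ u, normalPart (γ u - c) (θ u) = r * normalPart (p (θ u)) (θ u)) (u : ℝ) :
    γ u - c = r • p (θ u) := by
  have hd := h.isSupportData c
  have hb : Continuous fun u => tangentPart (p (θ u)) (θ u) :=
    hP.continuous_tangent.comp h.continuous_angle
  have hm := hd.continuous_tangent
  -- Differentiating the relation of support functions equates the tangential parts only where `κ`
  -- is nonzero. But `κ` vanishes on no interval, as `θ` is strictly increasing, so continuity gives
  -- equality everywhere.
  have hzero : ∀ u, angularRate γ u *
      (tangentPart (γ u - c) (θ u) - r * tangentPart (p (θ u)) (θ u)) = 0 := fun u => by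
    have h1 := (hd.hasDerivAt_support u).sub ((hd.hasDerivAt_ball_support hP u).const_mul r)
    have h2 : HasDerivAt (fun u => normalPart (γ u - c) (θ u) - r * normalPart (p (θ u)) (θ u))
        0 u := by
      simp only [hr, sub_self]
      exact hasDerivAt_const u 0
    have := h1.unique h2
    linarith
  have hn : tangentPart (γ u - c) (θ u) - r * tangentPart (p (θ u)) (θ u) = 0 := by
    by_contra hne
    have hev := (hm.sub (continuous_const.mul hb)).continuousAt.eventually_ne hne
    obtain ⟨ε, hε, hball⟩ := Metric.eventually_nhds_iff_ball.1 hev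
    have hconst := (convex_ball u ε).is_const_of_fderivWithin_eq_zero (𝕜 := ℝ) (f := θ)
      (fun v _ => (h.hasDerivAt_angle v).differentiableAt.differentiableWithinAt)
      (fun v hv => by
        have hκ : angularRate γ v = 0 := (mul_eq_zero.1 (hzero v)).resolve_right (hball v hv)
        rw [fderivWithin_of_isOpen Metric.isOpen_ball hv]
        have := h.hasDerivAt_angle v
        rw [hκ] at this
        rw [this.hasFDerivAt.fderiv]
        ext; simp)
      (Metric.mem_ball_self hε) (y := u + ε / 2) (by
        rw [Metric.mem_ball, Real.dist_eq, add_sub_cancel_left, abs_of_pos (by linarith)]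
        linarith)
    exact (h.strictMono (show u < u + ε / 2 by linarith)).ne hconst
  refine ext_of_parts (θ := θ u) ?_ ?_
  · rw [hr, normalPart_smul]
  · rw [tangentPart_smul]; linarith

lemma isPCircle_of_support_eq (hP : IsUnitBall P p) (h : IsOrientedCurve γ T θ σ) {c : Plane}
    {r : ℝ} (hr0 : 0 < r)
    (hr : ∀ u, normalPart (γ u - c) (θ u) = r * normalPart (p (θ u)) (θ u)) :
    IsPCircle P γ := by
  have heq := h.eq_of_support_eq hP hr
  refine ⟨c, r, hr0, Set.ext fun x => ⟨?_, fun hx => ?_⟩⟩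
  · rintro ⟨u, rfl⟩
    rw [Set.mem_ofPred_eq, heq, gauge_smul_of_nonneg hr0.le,
      hP.gauge_eq_one_iff.2 (Set.mem_range_self _), smul_eq_mul, mul_one]
  · rw [Set.mem_ofPred_eq] at hx
    have h1 : gauge P (r⁻¹ • (x - c)) = 1 := by
      rw [gauge_smul_of_nonneg (inv_nonneg.2 hr0.le), hx, smul_eq_mul, inv_mul_cancel₀ hr0.ne']
    obtain ⟨t, ht⟩ := hP.gauge_eq_one_iff.1 h1
    obtain ⟨u, rfl⟩ := h.angle_surjective t
    refine ⟨u, ?_⟩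
    rw [← sub_left_inj (a := c), heq, ht, smul_smul, mul_inv_cancel₀ hr0.ne', one_smul]

/-- Among the points of the curve, `γ u` is the only highest one in direction `θ u`, and on the
`P`-circle the point `c + r p (θ u)` is highest. -/
lemma eq_of_isPCircle (hP : IsUnitBall P p) (h : IsOrientedCurve γ T θ σ) {c : Plane} {r : ℝ}
    (hr0 : 0 < r) (hr : Set.range γ = {x | gauge P (x - c) = r}) (u : ℝ) :
    γ u = c + r • p (θ u) := by
  by_contra hne
  have hx : c + r • p (θ u) ∈ Set.range γ := by
    rw [hr, Set.mem_ofPred_eq, add_sub_cancel_left, gauge_smul_of_nonneg hr0.le,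
      hP.gauge_eq_one_iff.2 (Set.mem_range_self _), smul_eq_mul, mul_one]
  have h1 := h.normalPart_lt (subset_convexHull ℝ _ hx) (Ne.symm hne)
  have h2 : gauge P (γ u - c) = r := by
    have := Set.mem_range_self (f := γ) u
    rwa [hr, Set.mem_ofPred_eq] at this
  have h3 : gauge P (r⁻¹ • (γ u - c)) = 1 := by
    rw [gauge_smul_of_nonneg (inv_nonneg.2 hr0.le), h2, smul_eq_mul, inv_mul_cancel₀ hr0.ne']
  obtain ⟨t, ht⟩ := hP.gauge_eq_one_iff.1 h3
  have h4 : γ u = c + r • p t := by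
    rw [ht, smul_smul, mul_inv_cancel₀ hr0.ne', one_smul, add_sub_cancel]
  rw [h4, normalPart_add, normalPart_add, normalPart_smul, normalPart_smul] at h1
  have := mul_le_mul_of_nonneg_left (hP.normalPart_le (θ u) t) hr0.le
  linarith

/-- Differentiating `γ = c + r p(θ)` gives `σ = r ρ κ`, hence `k = 1/r`, `2 A = r L` and `L = 2 r
α`. -/
lemma curvatureSqIntegral_eq_of_isPCircle (hP : IsUnitBall P p) (h : IsOrientedCurve γ T θ σ)
    (hcirc : IsPCircle P γ) : curvatureSqIntegral P p γ T =
      area P * (lengthQ P γ T / enclosedArea γ) := by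
  obtain ⟨c, r, hr0, hr⟩ := hcirc
  have heq := h.eq_of_isPCircle hP hr0 hr
  have hσ : ∀ u, σ u = r * (IsUnitBall.radius p (θ u) * angularRate γ u) := fun u => by
    have hd : HasDerivAt γ (r • (angularRate γ u • deriv p (θ u))) u := by
      rw [show γ = fun u => c + r • p (θ u) from funext heq]
      have h1 := (((hP.hasDerivAt (θ u)).scomp u (h.hasDerivAt_angle u)).const_smul r).const_add c
      rw [show (fun u => c + r • p (θ u)) = γ from (funext heq).symm]
      rw [show γ = fun u => c + r • p (θ u) from funext heq] at h1 ⊢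
      exact h1
    rw [h.speed_eq, hd.deriv, hP.deriv_eq_radius, tangentPart_smul, tangentPart_smul,
      tangentPart_smul, tangentPart_eTheta]
    ring
  have hk : ∀ u, IsUnitBall.radius p (θ u) * angularRate γ u / σ u = r⁻¹ := fun u => by
    rw [div_eq_iff (h.speed_pos u).ne', hσ u, inv_mul_cancel_left₀ hr0.ne']
  have hCS : curvatureSqIntegral P p γ T = r⁻¹ ^ 2 * lengthQ P γ T := by
    rw [h.curvatureSqIntegral_eq hP 0, h.lengthQ_eq hP 0]
    simp only [hk]
    rw [integral_const_mul]
  have hA : enclosedArea γ = r * lengthQ P γ T / 2 := by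
    have h1 := h.integral_det2_sub c 0 T
    rw [h.curve.closed.eq, sub_self, sub_zero] at h1
    rw [h.enclosedArea_eq.1, ← h1, h.lengthQ_eq hP 0, zero_add, ← integral_const_mul]
    congr 1
    refine integral_congr fun u _ => ?_
    have hu : γ u - c = r • p (θ u) := by rw [heq u, add_sub_cancel_left]
    beta_reduce
    rw [h.det2_eq, hu, normalPart_smul, mul_assoc]
  have hL : lengthQ P γ T = 2 * r * area P := by
    obtain ⟨u₁, hu₁⟩ := h.angle_surjective (θ 0 + Real.pi)
    have hd := h.isSupportData c
    have i1 := hd.integral_ball hP hu₁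
    have i2 := hd.integral_ball hP (u₀ := u₁) (u₁ := 0 + T)
      (by rw [h.angle_add_period, hu₁]; ring)
    have hc : Continuous fun u =>
        normalPart (p (θ u)) (θ u) * IsUnitBall.radius p (θ u) * angularRate γ u :=
      ((hP.continuous_support.comp h.continuous_angle).mul
        (hP.continuous_radius.comp h.continuous_angle)).mul h.continuous_rate
    have hadd := integral_add_adjacent_intervals (μ := MeasureTheory.volume)
      (hc.intervalIntegrable 0 u₁) (hc.intervalIntegrable u₁ (0 + T))
    rw [i1, i2] at hadd
    have hPa : area P = boundaryArea p := hP.area_eq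
    rw [h.lengthQ_eq hP 0, hPa, mul_comm (2 : ℝ), mul_assoc, two_mul, hadd, ← integral_const_mul]
    refine integral_congr fun u _ => ?_
    simp only [hσ u]
    ring
  have hApos := h.enclosedArea_eq.2
  rw [hA] at hApos
  have hLpos : 0 < lengthQ P γ T := by
    by_contra hn
    nlinarith
  rw [hCS, hA]
  have hαpos : 0 < area P := by
    by_contra hn
    nlinarith [mul_nonneg hr0.le (neg_nonneg.2 (not_lt.1 hn))]
  rw [hL]
  field_simp

/-- The inequality for curves run through counterclockwise. -/
theorem curvatureSqIntegral_ge (hP : IsUnitBall P p) (h : IsOrientedCurve γ T θ σ) :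
    area P * (lengthQ P γ T / enclosedArea γ) ≤ curvatureSqIntegral P p γ T ∧
      (curvatureSqIntegral P p γ T = area P * (lengthQ P γ T / enclosedArea γ) →
        IsPCircle P γ) := by
  obtain ⟨c, u₀, u₁, hturn, hchord, hA1, hA2⟩ := h.exists_bisecting_chord
  have hd := h.isSupportData c
  have hturn2 : θ (u₀ + T) = θ u₁ + Real.pi := by rw [h.angle_add_period, hturn]; ring
  have hgp : ∀ u, normalPart (γ (u + T) - c) (θ (u + T)) = normalPart (γ u - c) (θ u) := fun u => by
    rw [h.curve.closed, h.angle_add_period, normalPart_add_two_pi]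
  have hmp : tangentPart (γ (u₀ + T) - c) (θ (u₀ + T)) = tangentPart (γ u₀ - c) (θ u₀) := by
    rw [h.curve.closed, h.angle_add_period, two_mul, ← add_assoc, tangentPart_add_pi,
      tangentPart_add_pi, neg_neg]
  have hg : normalPart (γ u₁ - c) (θ u₁) = normalPart (γ u₀ - c) (θ u₀) := by
    rw [hchord, hturn, normalPart_neg, normalPart_add_pi, neg_neg]
  have hm : tangentPart (γ u₁ - c) (θ u₁) = tangentPart (γ u₀ - c) (θ u₀) := by
    rw [hchord, hturn, tangentPart_neg, tangentPart_add_pi, neg_neg]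
  have hg2 := (hgp u₀).trans hg.symm
  have hm2 := hmp.trans hm.symm
  simp only [h.det2_eq] at hA1 hA2
  have hPa : area P = boundaryArea p := hP.area_eq
  have hα := hP.boundaryArea_pos
  have hA := h.enclosedArea_eq.2
  have hθ := h.continuous_angle
  have hgc : Continuous fun u => normalPart (γ u - c) (θ u) := hd.continuous_support
  have hκ := h.continuous_rate
  have hσ := h.continuous_speed
  have ha : Continuous fun u => normalPart (p (θ u)) (θ u) := hP.continuous_support.comp hθ
  have hr : Continuous fun u => IsUnitBall.radius p (θ u) := hP.continuous_radius.comp hθ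
  have hq : Continuous fun u => normalPart (γ u - c) (θ u) / normalPart (p (θ u)) (θ u) :=
    hgc.div ha fun u => (hP.support_pos _).ne'
  have hk : Continuous fun u => IsUnitBall.radius p (θ u) * angularRate γ u / σ u :=
    (hr.mul hκ).div hσ fun u => (h.speed_pos u).ne'
  -- the length, the mixed area and the square integral of the support function
  have haσ : Continuous fun u => normalPart (p (θ u)) (θ u) * σ u := ha.mul hσ
  have hgrκ : Continuous fun u =>
    normalPart (γ u - c) (θ u) * IsUnitBall.radius p (θ u) * angularRate γ u := (hgc.mul hr).mul hκ
  have hqaσ : Continuous fun u => (normalPart (γ u - c) (θ u) / normalPart (p (θ u)) (θ u)) ^ 2 *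
    (normalPart (p (θ u)) (θ u) * σ u) := (hq.pow 2).mul haσ
  have hLadd := integral_add_adjacent_intervals (μ := MeasureTheory.volume)
    (haσ.intervalIntegrable u₀ u₁) (haσ.intervalIntegrable u₁ (u₀ + T))
  have hMadd := integral_add_adjacent_intervals (μ := MeasureTheory.volume)
    (hgrκ.intervalIntegrable u₀ u₁) (hgrκ.intervalIntegrable u₁ (u₀ + T))
  have hHadd := integral_add_adjacent_intervals (μ := MeasureTheory.volume)
    (hqaσ.intervalIntegrable u₀ u₁) (hqaσ.intervalIntegrable u₁ (u₀ + T))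
  have hM1 := hd.mixed_area hP hturn hg hm
  have hM2 := hd.mixed_area hP hturn2 hg2 hm2
  have hS1 := hd.integral_sq_le hP hturn hg hm
  have hS2 := hd.integral_sq_le hP hturn2 hg2 hm2
  have hC1 := fun e φ hφ => hd.ratio_const_of_integral_sq_eq hP hturn hg hm e (φ := φ) hφ
  have hC2 := fun e φ hφ => hd.ratio_const_of_integral_sq_eq hP hturn2 hg2 hm2 e (φ := φ) hφ
  rw [hM1, hM2, hLadd, ← h.lengthQ_eq hP u₀] at hMadd
  rw [← h.lengthQ_eq hP u₀] at hLadd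
  have hCS := h.curvatureSqIntegral_eq hP u₀
  rw [hA1] at hS1 hC1
  rw [hA2] at hS2 hC2
  set A := enclosedArea γ
  set L := lengthQ P γ T
  set α := boundaryArea p
  set H := ∫ u in u₀..u₀ + T, (normalPart (γ u - c) (θ u) / normalPart (p (θ u)) (θ u)) ^ 2 *
    (normalPart (p (θ u)) (θ u) * σ u) with hH
  have hHle : α * H ≤ A * L := by
    rw [← hHadd, ← hLadd, mul_add, mul_add]
    exact add_le_add hS1 hS2
  -- The factor for which `k = t (g/a)` on a `P`-circle centred at `c`. With it, `∫ (k - t g/a)² ds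
  -- ≥ 0` takes the place of Cauchy–Schwarz, the cross term being `∫ (g/a) k ds = L`.
  set t := α / A with ht
  have htpos : 0 < t := div_pos hα hA
  have htA : t * A = α := div_mul_cancel₀ _ hA.ne'
  have hTpos := h.curve.period_pos
  have hmain : 2 * t * L - t ^ 2 * H ≤ curvatureSqIntegral P p γ T := by
    rw [hCS, hMadd, hH, ← integral_const_mul, ← integral_const_mul,
      ← integral_sub (Continuous.intervalIntegrable (by fun_prop) _ _)
        (Continuous.intervalIntegrable (by fun_prop) _ _)]
    refine integral_mono_on (by linarith) (Continuous.intervalIntegrable (by fun_prop) _ _)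
      (Continuous.intervalIntegrable (by fun_prop) _ _) fun u _ => ?_
    have h1 := hP.support_pos (θ u)
    have h2 := h.speed_pos u
    have h3 : normalPart (γ u - c) (θ u) * IsUnitBall.radius p (θ u) * angularRate γ u =
        (IsUnitBall.radius p (θ u) * angularRate γ u / σ u) *
        (normalPart (γ u - c) (θ u) / normalPart (p (θ u)) (θ u)) *
        (normalPart (p (θ u)) (θ u) * σ u) := by
      field_simp
    rw [h3]
    have h4 := mul_nonneg (sq_nonneg (IsUnitBall.radius p (θ u) * angularRate γ u / σ u -
      t * (normalPart (γ u - c) (θ u) / normalPart (p (θ u)) (θ u)))) (mul_pos h1 h2).le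
    linarith
  have hgoal : area P * (L / A) = t * L := by rw [hPa, ht]; ring
  have hHle' : t ^ 2 * H ≤ t * L := by
    have : t * (A * (t * H)) ≤ t * (A * L) := by
      have := mul_le_mul_of_nonneg_left hHle htpos.le
      rw [← htA] at this
      linarith
    have := le_of_mul_le_mul_left (le_of_mul_le_mul_left this htpos) hA
    nlinarith
  rw [hgoal]
  refine ⟨by linarith, fun heq => ?_⟩
  -- Equality forces `t² H = t L`. As the bounds for the two arcs add up to this one, each of them
  -- is an equality.
  have hHeq : α * H = A * L := by
    have h1 : t * L = t * (t * H) := by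
      refine le_antisymm ?_ (by linarith)
      linarith
    have h2 := mul_left_cancel₀ htpos.ne' h1
    rw [h2, ← htA]; ring
  rw [← hHadd, ← hLadd, mul_add, mul_add] at hHeq
  have hc1 := hC1 (by linarith)
  have hc2 := hC2 (by linarith)
  set r := normalPart (γ u₀ - c) (θ u₀) / normalPart (p (θ u₀)) (θ u₀) with hrdef
  have hu01 : u₀ ≤ u₁ := (h.strictMono.lt_iff_lt.1 (by rw [hturn]; linarith [Real.pi_pos])).le
  have hu1 := hc1 u₁ ⟨hu01, le_rfl⟩
  -- The ratio is constant on each arc, and the arcs share the parameter `u₁`.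
  have hIcc : ∀ u ∈ Set.Icc u₀ (u₀ + T),
      normalPart (γ u - c) (θ u) / normalPart (p (θ u)) (θ u) = r := fun u hu => by
    rcases le_total u u₁ with hle | hle
    · exact hc1 u ⟨hu.1, hle⟩
    · exact (hc2 u ⟨hle, hu.2⟩).trans hu1
  have hperiodic : Function.Periodic
      (fun u => normalPart (γ u - c) (θ u) / normalPart (p (θ u)) (θ u)) T := fun u => by
    have := h.support_periodic hP u
    simp only at this
    simp only [hgp, this]
  have hall : ∀ u, normalPart (γ u - c) (θ u) = r * normalPart (p (θ u)) (θ u) := fun u => by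
    obtain ⟨v, hv, hvu⟩ := hperiodic.exists_mem_Ico hTpos u u₀
    simp only [hIcc v ⟨hv.1, hv.2.le⟩] at hvu
    rw [← hvu, div_mul_cancel₀ _ (hP.support_pos _).ne']
  refine h.isPCircle_of_support_eq hP ?_ hall
  -- Positivity of `r`: the area `A` is `r` times the length of an arc.
  have hAr : A = r * ∫ u in u₀..u₁, normalPart (p (θ u)) (θ u) * σ u := by
    rw [← hA1, ← integral_const_mul]
    refine integral_congr fun u _ => ?_
    simp only [hall u, mul_assoc]
  have hl : 0 ≤ ∫ u in u₀..u₁, normalPart (p (θ u)) (θ u) * σ u :=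
    integral_nonneg hu01 fun u _ => (mul_pos (hP.support_pos _) (h.speed_pos u)).le
  rw [hAr] at hA
  exact pos_of_mul_pos_left hA hl

end IsOrientedCurve

/-! ### Invariance under reversal of orientation -/

section Reversal

variable {P : Set Plane} {p γ : ℝ → Plane} {T : ℝ}

lemma speedQ_reverse (P : Set Plane) (γ : ℝ → Plane) (u : ℝ) :
    speedQ P (fun u => γ (-u)) u = speedQ P γ (-u) := by
  rw [speedQ, deriv_comp_neg, gauge_neg, speedQ]
  intro x hx w hw
  have := hx w hw
  rwa [← neg_one_smul ℝ, det2_smul_right, abs_mul, abs_neg, abs_one, one_mul]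

lemma angularRate_reverse (γ : ℝ → Plane) (u : ℝ) :
    angularRate (fun u => γ (-u)) u = -angularRate γ (-u) := by
  have h1 : deriv (fun u => γ (-u)) = fun u => -deriv γ (-u) := funext fun u => deriv_comp_neg γ u
  have h2 : deriv (deriv fun u => γ (-u)) u = deriv (deriv γ) (-u) := by
    rw [h1, deriv.fun_neg, deriv_comp_neg, neg_neg]
  rw [angularRate, h2, h1, angularRate, norm_neg]
  simp only [det2, PiLp.neg_apply]
  ring

/-- Reversal shifts the tangent angle by `π`, which leaves `[p, p']` unchanged by central symmetry,
and flips the turning rate. So `k` changes sign and `k² ds` does not. -/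
lemma curvature_reverse (hP : IsUnitBall P p) (hγ : IsStrictlyConvexCurve γ T) (u : ℝ) :
    curvature P p (fun u => γ (-u)) u = -curvature P p γ (-u) := by
  obtain ⟨c, hc, h1⟩ := exists_eTheta_eq (hγ.reverse.regular u)
  obtain ⟨d, hd, h2⟩ := exists_eTheta_eq (hγ.regular (-u))
  have he : eTheta (tangentParam (fun u => γ (-u)) u) =
      eTheta (tangentParam γ (-u) + Real.pi) := by
    refine eTheta_eq_of_smul_eq hc hd ?_
    rw [eTheta_add_pi, smul_neg, tangentParam, tangentParam, ← h1, ← h2, deriv_comp_neg]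
  have hdet : det2 (p (tangentParam γ (-u) + Real.pi)) (deriv p (tangentParam γ (-u) + Real.pi)) =
      det2 (p (tangentParam γ (-u))) (deriv p (tangentParam γ (-u))) := by
    rw [hP.det2_deriv, hP.det2_deriv, hP.support_add_pi, hP.radius_add_pi]
  rw [curvature, curvature, hP.det2_deriv_congr he, hdet, speedQ_reverse, angularRate_reverse]
  ring

lemma integral_reverse {f : ℝ → ℝ} (hf : Function.Periodic f T) :
    ∫ u in (0 : ℝ)..T, f (-u) = ∫ u in (0 : ℝ)..T, f u := by
  have := hf.intervalIntegral_add_eq (-T) 0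
  rw [neg_add_cancel, zero_add] at this
  rw [integral_comp_neg, neg_zero, this]

lemma speedQ_periodic (P : Set Plane) (hγ : IsStrictlyConvexCurve γ T) :
    Function.Periodic (speedQ P γ) T := fun u => by
  rw [speedQ, speedQ, hγ.deriv_periodic]

lemma curvature_periodic (P : Set Plane) (p : ℝ → Plane) (hγ : IsStrictlyConvexCurve γ T) :
    Function.Periodic (curvature P p γ) T := fun u => by
  have h2 : deriv (deriv γ) (u + T) = deriv (deriv γ) u := by
    rw [← deriv_comp_add_const]
    congr 1
    exact funext hγ.deriv_periodic
  simp only [curvature, tangentParam, angularRate, speedQ, hγ.deriv_periodic u, h2]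

lemma lengthQ_reverse (P : Set Plane) (hγ : IsStrictlyConvexCurve γ T) :
    lengthQ P (fun u => γ (-u)) T = lengthQ P γ T := by
  simp only [lengthQ, speedQ_reverse]
  exact integral_reverse (speedQ_periodic P hγ)

lemma curvatureSqIntegral_reverse (hP : IsUnitBall P p) (hγ : IsStrictlyConvexCurve γ T) :
    curvatureSqIntegral P p (fun u => γ (-u)) T = curvatureSqIntegral P p γ T := by
  simp only [curvatureSqIntegral, speedQ_reverse, curvature_reverse hP hγ, neg_sq]
  refine integral_reverse (f := fun u => curvature P p γ u ^ 2 * speedQ P γ u) fun u => ?_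
  simp only [speedQ_periodic P hγ u, curvature_periodic P p hγ u]

lemma range_reverse (γ : ℝ → Plane) : Set.range (fun u => γ (-u)) = Set.range γ :=
  (Equiv.neg ℝ).surjective.range_comp γ

end Reversal

end MinkowskiPlane

end

theorem corollary1 (P : Set MinkowskiPlane.Plane) (p : ℝ → MinkowskiPlane.Plane)
    (hP : MinkowskiPlane.IsUnitBall P p)
    (γ : ℝ → MinkowskiPlane.Plane) (T : ℝ)
    (hγ : MinkowskiPlane.IsStrictlyConvexCurve γ T) :
    MinkowskiPlane.curvatureSqIntegral P p γ T ≥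
        MinkowskiPlane.area P *
          (MinkowskiPlane.lengthQ P γ T / MinkowskiPlane.enclosedArea γ) ∧
      (MinkowskiPlane.curvatureSqIntegral P p γ T =
          MinkowskiPlane.area P *
            (MinkowskiPlane.lengthQ P γ T / MinkowskiPlane.enclosedArea γ) ↔
        MinkowskiPlane.IsPCircle P γ) := by
  rcases hγ.isCounterclockwise_or with hccw | hccw
  · obtain ⟨θ, σ, h⟩ := hγ.exists_oriented hccw
    exact ⟨(h.curvatureSqIntegral_ge hP).1, (h.curvatureSqIntegral_ge hP).2,
      h.curvatureSqIntegral_eq_of_isPCircle hP⟩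
  · obtain ⟨θ, σ, h⟩ := hγ.reverse.exists_oriented hccw
    have h1 := h.curvatureSqIntegral_ge hP
    have h2 := h.curvatureSqIntegral_eq_of_isPCircle hP
    simp only [MinkowskiPlane.IsPCircle, MinkowskiPlane.enclosedArea,
      MinkowskiPlane.range_reverse, MinkowskiPlane.curvatureSqIntegral_reverse hP hγ,
      MinkowskiPlane.lengthQ_reverse P hγ] at h1 h2
    exact ⟨h1.1, h1.2, h2⟩
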